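/- **Conventions.** Smoothness is meant in the Michal–Bastiani sense (continuity, existence of all iterated directional derivatives, and joint continuity of all the maps $D^jf : U\times E^j\to F$). A locally convex Lie group is a group with a smooth manifold structure modelled on a real Hausdorff locally convex space, for which multiplication and inversion are smooth. $\mathcal H$ is a complex Hilbert space with scalar product linear in the second argument, $\mathbb T=\{z\in\mathbb C:|z|=1\}$, $\mathrm{PU}(\mathcal H)=\mathrm U(\mathcal H)/\mathbb T\mathbf 1$, and $\overline U$ is the class of $U$. For a homomorphism $\overline\rho:G\to \mathrm{PU}(\mathcal H)$, a ray $[\psi]\in\mathbb P(\mathcal H)$ is called continuous (smooth) if its orbit map $G\to\mathbb P(\mathcal H)$, $g\mapsto\overline\rho(g)[\psi]$ is continuous (smooth), where $\mathbb P(\mathcal H)$ is the projective Hilbert manifold; $\overline\rho$ is called continuous if the continuous rays are dense in $\mathbb P(\mathcal H)$. Put $G^\sharp=\{(g,U)\in G\times \mathrm U(\mathcal H):\overline\rho(g)=\overline U\}$, a central extension of the group $G$ by $\mathbb T$ with inclusion $z\mapsto(\mathbf 1,z\mathbf 1)$ and projection $(g,U)\mapsto g$, and let $\widehat\rho(g,U)=U$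 be its unitary representation on $\mathcal H$. A vector $\phi$ is smooth for $\widehat\rho$ if its orbit map $G^\sharp\to\mathcal H$, $\gamma\mapsto\widehat\rho(\gamma)\phi$ is smooth, for a given Lie group structure on $G^\sharp$. Two Lie group structures on $G^\sharp$ coincide if the identity map is a diffeomorphism between them. **Theorem.** Let $G$ be a connected locally convex Lie group, $\overline\rho:G\to \mathrm{PU}(\mathcal H)$ a group homomorphism (a projective unitary representation), and $\psi\in\mathcal H\setminus\{0\}$ such that the ray $[\psi]$ is smooth. Then the following assertions hold. (i) $U_\psi=\{g\in G:\overline\rho(g)[\psi]\not\perp[\psi]\}$ is an open symmetric neighbourhood of $\mathbf 1$ in $G$. For each $g\in U_\psi$ there is a unique $\rho_\psi(g)\in \mathrm U(\mathcal H)$ with $\overline{\rho_\psi(g)}=\overline\rho(g)$ and $\langle\psi,\rho_\psi(g)\psi\rangle>0$. The map $U_\psi\to\mathcal H$, $g\mapsto\rho_\psi(g)\psi$ is smooth, and $\rho_\psi(g^{-1})=\rho_\psi(g)^{-1}$ for $g\in U_\psi$. (ii) There is a unique locally convex Lie group structure on $G^\sharp$ for which the $\mathbb T$-equivariant map $\tau_\psi:U_\psi\times\mathbb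 T\to G^\sharp$, $(g,z)\mapsto(g,\rho_\psi(g)z)$ is a diffeomorphism onto an open subset of $G^\sharp$. With it, $\mathbb T\to G^\sharp\to G$ is a central extension of locally convex Lie groups (an exact sequence of smooth homomorphisms with central image of $\mathbb T$), and $G^\sharp\to G$ is a smooth, locally trivial principal $\mathbb T$-bundle. If $\overline\rho$ is continuous, then the topology of this Lie group is that of $G^\sharp$ as a topological group, i.e. the subspace topology of $G\times \mathrm U(\mathcal H)$ with the strong operator topology on $\mathrm U(\mathcal H)$. (iii) With respect to the Lie group structure of (ii), $\psi$ is a smooth vector for $\widehat\rho$. (iv) If $\phi\in\mathcal H$ satisfies $\langle\psi,\phi\rangle\neq0$ and the ray $[\phi]$ is smooth, then $\phi$ is a smooth vector for $\widehat\rho$ with respect to the Lie group structure obtained from $[\psi]$, and the Lie group structures on $G^\sharp$ obtained from $[\phi]$ and $[\psi]$ as in (ii) coincide. (v) If the set of smooth rays is dense in $\mathbb P(\mathcal H)$, then for every smooth ray $[\phi]$ the Lie group structure on $G^\sharp$ obtained from $[\phi]$ coincides with the one obtained from $[\psi]$, and a vector $\phi\in\mathcal H\setminus\{0\}$ is smooth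 for $\widehat\rho$ if and only if its ray $[\phi]$ is smooth. -/

import Mathlib

open Set Filter Topology
open scoped LinearAlgebra.Projectivization

universe u v w

noncomputable section

/-! ### Smooth maps between open subsets of locally convex spaces -/

section Calculus

variable {E F : Type*} [AddCommGroup E] [Module ℝ E] [TopologicalSpace E]
  [AddCommGroup F] [Module ℝ F] [TopologicalSpace F]

/-- `y` is the derivative `∂_h f(x) = lim_{t → 0} t⁻¹ (f (x + t h) - f x)` of `f` at `x` in
direction `h` (in particular the limit exists). -/
def HasDirDeriv (f : E → F) (x h : E) (y : F) : Prop :=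
  Tendsto (fun t : ℝ => t⁻¹ • (f (x + t • h) - f x)) (𝓝[≠] 0) (𝓝 y)

/-- `f` is smooth (`C^∞`) on the open set `U`: all iterated directional derivatives
`D^j f (x) (h₁, …, h_j) = (∂_{h_j} ⋯ ∂_{h₁} f) (x)` exist for `x ∈ U`, and all the maps
`D^j f : U × E^j → F` are continuous (the case `j = 0` being the continuity of `f`). -/
def SmoothOnOpen (f : E → F) (U : Set E) : Prop :=
  ∃ D : (j : ℕ) → E → (Fin j → E) → F,
    (∀ x ∈ U, ∀ h, D 0 x h = f x) ∧
    (∀ j, ∀ x ∈ U, ∀ (h : Fin j → E) (v : E),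
      HasDirDeriv (fun y => D j y h) x v (D (j + 1) x (Fin.snoc h v))) ∧
    ∀ j, ContinuousOn (fun p : E × (Fin j → E) => D j p.1 p.2) (U ×ˢ univ)

end Calculus

/-! ### Smooth maps between manifolds modelled on locally convex spaces -/

/-- The product of manifolds modelled on `E` and `F` is modelled on `E × F`, with the products of
charts as charts. -/
instance prodChart (E F M N : Type*) [TopologicalSpace E] [TopologicalSpace F]
    [TopologicalSpace M] [TopologicalSpace N] [ChartedSpace E M] [ChartedSpace F N] :
    ChartedSpace (E × F) (M × N) :=
  inferInstanceAs (ChartedSpace (ModelProd E F) (M × N))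

section Manifolds

variable (E F : Type*) [AddCommGroup E] [Module ℝ E] [TopologicalSpace E]
  [AddCommGroup F] [Module ℝ F] [TopologicalSpace F]
variable {M N : Type*} [TopologicalSpace M] [ChartedSpace E M]
  [TopologicalSpace N] [ChartedSpace F N]

/-- `f` is smooth on the open subset `s` of the manifold `M` modelled on `E`, with values in the
manifold `N` modelled on `F`: it is continuous on `s`, and smooth in all charts. -/
def SmoothMapOn (f : M → N) (s : Set M) : Prop :=
  ContinuousOn f s ∧ ∀ e ∈ atlas E M, ∀ e' ∈ atlas F N,
    SmoothOnOpen (fun x => e' (f (e.symm x))) (e.target ∩ e.symm ⁻¹' (s ∩ f ⁻¹' e'.source))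

/-- `f` restricts to a diffeomorphism of the open set `s` onto the open set `t`. -/
def IsDiffeoOn (f : M → N) (s : Set M) (t : Set N) : Prop :=
  SmoothMapOn E F f s ∧ MapsTo f s t ∧
    ∃ k : N → M, SmoothMapOn F E k t ∧ MapsTo k t s ∧ InvOn k f s t

end Manifolds

/-! ### Locally convex Lie groups -/

/-- The charted space `G` modelled on the locally convex space `E` is a smooth manifold (the
coordinate changes are smooth), and the group operations are smooth. (As these are continuous and
`E` is Hausdorff, `G` is automatically Hausdorff.) -/
class IsLocConvexLieGroup (E G : Type*) [AddCommGroup E] [Module ℝ E] [TopologicalSpace E]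
    [IsTopologicalAddGroup E] [ContinuousSMul ℝ E] [LocallyConvexSpace ℝ E] [T2Space E]
    [Group G] [TopologicalSpace G] [ChartedSpace E G] : Prop where
  compatible : ∀ e ∈ atlas E G, ∀ e' ∈ atlas E G,
    SmoothOnOpen (fun x => e' (e.symm x)) (e.target ∩ e.symm ⁻¹' e'.source)
  smooth_mul : SmoothMapOn (E × E) E (fun p : G × G => p.1 * p.2) univ
  smooth_inv : SmoothMapOn E E (fun g : G => g⁻¹) univ

/-- The structures of a locally convex Lie group on a given abstract group `Γ`. -/
structure LieGroupStructure (Γ : Type v) [Group Γ] where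
  Model : Type u
  [addCommGroup : AddCommGroup Model]
  [module : Module ℝ Model]
  [modelTop : TopologicalSpace Model]
  [isTopologicalAddGroup : IsTopologicalAddGroup Model]
  [continuousSMul : ContinuousSMul ℝ Model]
  [locallyConvex : LocallyConvexSpace ℝ Model]
  [hausdorff : T2Space Model]
  [top : TopologicalSpace Γ]
  [charts : ChartedSpace Model Γ]
  [isLieGroup : IsLocConvexLieGroup Model Γ]

namespace LieGroupStructure

attribute [instance] addCommGroup module modelTop isTopologicalAddGroup continuousSMul
  locallyConvex hausdorff

variable {Γ : Type*} [Group Γ]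

/-- The group `Γ`, regarded as a Lie group by means of `L`. -/
@[nolint unusedArguments]
def Carrier (_L : LieGroupStructure Γ) : Type _ := Γ

variable (L L' : LieGroupStructure Γ)

instance : Group L.Carrier := inferInstanceAs (Group Γ)
instance : TopologicalSpace L.Carrier := L.top
instance : ChartedSpace L.Model L.Carrier := L.charts
instance : IsLocConvexLieGroup L.Model L.Carrier := L.isLieGroup

/-- The identity map of `Γ`, as a map from the abstract group to the Lie group. -/
def toCarrier (γ : Γ) : L.Carrier := γ

/-- Two Lie group structures on `Γ` coincide if the identity map of `Γ` is a diffeomorphism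
between them. -/
def Coincide : Prop :=
  IsDiffeoOn L.Model L'.Model (fun γ : L.Carrier => L'.toCarrier γ) univ univ

end LieGroupStructure

/-- The model space of the circle group `Circle`. -/
abbrev CircleModel : Type := EuclideanSpace ℝ (Fin 1)

/-- `1 → 𝕋 → Γ → G → 1` is a central extension of locally convex Lie groups: an exact sequence of
morphisms of Lie groups with central kernel such that `Γ → G` is a locally trivial principal
`𝕋`-bundle. -/
structure IsCentralLieExtension (E F : Type*)
    [AddCommGroup E] [Module ℝ E] [TopologicalSpace E]
    [AddCommGroup F] [Module ℝ F] [TopologicalSpace F]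
    {G Γ : Type*} [Group G] [TopologicalSpace G] [ChartedSpace E G]
    [Group Γ] [TopologicalSpace Γ] [ChartedSpace F Γ]
    (ι : Circle →* Γ) (π : Γ →* G) : Prop where
  smooth_ι : SmoothMapOn CircleModel F ι univ
  smooth_π : SmoothMapOn F E π univ
  injective : Function.Injective ι
  exact : ι.range = π.ker
  surjective : Function.Surjective π
  central : ∀ z γ, ι z * γ = γ * ι z
  smooth_action : SmoothMapOn (F × CircleModel) F (fun p : Γ × Circle => p.1 * ι p.2) univ
  locally_trivial : ∀ g₀ : G, ∃ U : Set G, IsOpen U ∧ g₀ ∈ U ∧ ∃ t : G × Circle → Γ,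
    IsDiffeoOn (E × CircleModel) F t (U ×ˢ univ) (π ⁻¹' U) ∧
    ∀ g ∈ U, ∀ z, π (t (g, z)) = g ∧ ∀ w, t (g, z * w) = t (g, z) * ι w

/-! ### The projective space and the projective unitary group of a Hilbert space -/

section Hilbert

variable (H : Type*) [NormedAddCommGroup H] [InnerProductSpace ℂ H]

/-- The projective space carries the quotient topology of `H \ {0}`. -/
instance projTop : TopologicalSpace (ℙ ℂ H) :=
  TopologicalSpace.coinduced (fun v : {v : H // v ≠ 0} => Projectivization.mk ℂ v.1 v.2) inferInstance

variable {H}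

/-- The domain `{[χ] : ⟨φ, χ⟩ ≠ 0}` of the affine chart of `ℙ(H)` centred at `[φ]`. -/
def affineDomain (φ : H) : Set (ℙ ℂ H) := {p | inner ℂ φ p.rep ≠ 0}

/-- The affine chart of `ℙ(H)` centred at `[φ]`, which maps the ray `[φ + u]` to `u ∈ φ^⊥`; that is,
`[χ]` is mapped to the `φ^⊥`-component of `(‖φ‖² / ⟨φ, χ⟩) χ`. -/
def affineChart (φ : H) (p : ℙ ℂ H) : (ℂ ∙ φ)ᗮ :=
  (ℂ ∙ φ)ᗮ.orthogonalProjectionOnto (((‖φ‖ : ℂ) ^ 2 / inner ℂ φ p.rep) • p.rep)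

theorem affineChart_mk (φ : H) (hφ : φ ≠ 0) (u : (ℂ ∙ φ)ᗮ) (h : φ + u ≠ 0) :
    affineChart φ (Projectivization.mk ℂ (φ + u) h) = u := by
  obtain ⟨a, ha⟩ := Projectivization.exists_smul_eq_mk_rep ℂ (φ + (u : H)) h
  have hu : inner ℂ φ (u : H) = 0 := Submodule.mem_orthogonal_singleton_iff_inner_right.1 u.2
  have ha0 : (a : ℂ) ≠ 0 := a.ne_zero
  have hn : (‖φ‖ : ℂ) ≠ 0 := by simpa using hφ
  have hin : inner ℂ φ ((a : ℂ) • (φ + (u : H))) = a * (‖φ‖ : ℂ) ^ 2 := by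
    rw [inner_smul_right, inner_add_right, hu, inner_self_eq_norm_sq_to_K]; simp
  unfold affineChart
  rw [← ha]
  change (ℂ ∙ φ)ᗮ.orthogonalProjectionOnto
    (((‖φ‖ : ℂ) ^ 2 / inner ℂ φ ((a : ℂ) • (φ + (u : H)))) • ((a : ℂ) • (φ + (u : H)))) = u
  rw [hin, smul_smul]
  have : (‖φ‖ : ℂ) ^ 2 / (a * (‖φ‖ : ℂ) ^ 2) * a = 1 := by field_simp
  rw [this, one_smul, map_add, Submodule.orthogonalProjectionOnto_orthogonalComplement_singleton_eq_zero,
    zero_add, Submodule.orthogonalProjectionOnto_mem_subspace_eq_self]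

/-- Smooth maps from a manifold modelled on `E` to the Hilbert manifold `ℙ(H)`, whose atlas consists
of the affine charts. -/
def SmoothToProj (E : Type*) [AddCommGroup E] [Module ℝ E] [TopologicalSpace E]
    {M : Type*} [TopologicalSpace M] [ChartedSpace E M] (f : M → ℙ ℂ H) : Prop :=
  Continuous f ∧ ∀ φ : H, φ ≠ 0 →
    SmoothMapOn E (ℂ ∙ φ)ᗮ (fun m => affineChart φ (f m)) (f ⁻¹' affineDomain φ)

variable (H) [CompleteSpace H]

/-- The unitary group `U(H)`. -/
abbrev UnitaryGp : Type _ := unitary (H →L[ℂ] H)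

/-- The homomorphism `z ↦ z 1` from the circle group to `U(H)`. -/
def scalarUnitary : Circle →* UnitaryGp H where
  toFun z := ⟨(z : ℂ) • (1 : H →L[ℂ] H), by
    have h1 : (starRingEnd ℂ) (z : ℂ) * (z : ℂ) = 1 := by
      rw [← Circle.coe_inv_eq_conj, ← Circle.coe_mul]; simp
    have h2 : (z : ℂ) * (starRingEnd ℂ) (z : ℂ) = 1 := by rw [mul_comm]; exact h1
    rw [Unitary.mem_iff]
    constructor <;> simp [smul_smul, h1, h2]⟩
  map_one' := by ext; simp
  map_mul' z w := by ext v; simp [smul_smul, mul_comm]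

instance scalarUnitary_range_normal : (scalarUnitary H).range.Normal where
  conj_mem := by
    rintro _ ⟨z, rfl⟩ U
    refine ⟨z, ?_⟩
    rw [eq_mul_inv_iff_mul_eq]
    ext v
    simp [scalarUnitary]

/-- The projective unitary group `PU(H) = U(H) / 𝕋 1`. -/
abbrev ProjUnitaryGp : Type _ := UnitaryGp H ⧸ (scalarUnitary H).range

/-- The action of `PU(H)` on the projective space, induced from `U [v] = [U v]`. -/
instance projUnitaryAction : MulAction (ProjUnitaryGp H) (ℙ ℂ H) :=
  MulAction.compHom (ℙ ℂ H) (QuotientGroup.lift (scalarUnitary H).range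
    (MulAction.toPermHom (UnitaryGp H) (ℙ ℂ H)) (by
      rintro _ ⟨z, rfl⟩
      ext p
      induction p using Projectivization.ind with
      | h v hv =>
        change scalarUnitary H z • Projectivization.mk ℂ v hv = Projectivization.mk ℂ v hv
        rw [Projectivization.smul_mk, Projectivization.mk_eq_mk_iff']
        exact ⟨(z : ℂ), rfl⟩))

variable {H}

theorem projUnitary_smul_mk (U : UnitaryGp H) (v : H) (hv : v ≠ 0) (hv' : U • v ≠ 0) :
    (U : ProjUnitaryGp H) • Projectivization.mk ℂ v hv = Projectivization.mk ℂ (U • v) hv' := rfl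

/-! ### Projective unitary representations -/

section Rep

variable {G : Type*} [Group G] (ρ : G →* ProjUnitaryGp H)

/-- The ray `p` is smooth: its orbit map `G → ℙ(H)` is smooth. -/
def IsSmoothRay (E : Type*) [AddCommGroup E] [Module ℝ E] [TopologicalSpace E]
    [TopologicalSpace G] [ChartedSpace E G] (p : ℙ ℂ H) : Prop :=
  SmoothToProj E (fun g : G => ρ g • p)

/-- The projective unitary representation `ρ` is continuous: the rays with a continuous orbit map
are dense. -/
def IsContinuousProjRep [TopologicalSpace G] : Prop :=
  Dense {p : ℙ ℂ H | Continuous fun g : G => ρ g • p}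

/-- The set of all `g` for which the rays `ρ(g) p` and `p` are not orthogonal. -/
def nonOrthSet (p : ℙ ℂ H) : Set G := {g | ¬ (ρ g • p).submodule ⟂ p.submodule}

/-- `U` is a lift of `ρ(g)` to `U(H)` with `⟨ψ, U ψ⟩ > 0`. -/
def IsNormalizedLift (ψ : H) (g : G) (U : UnitaryGp H) : Prop :=
  (U : ProjUnitaryGp H) = ρ g ∧ 0 < (inner ℂ ψ (U • ψ)).re ∧ (inner ℂ ψ (U • ψ)).im = 0

theorem exists_normalizedLift (ψ : H) (hψ : ψ ≠ 0) (g : G) :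
    ∃ U : UnitaryGp H, (U : ProjUnitaryGp H) = ρ g ∧
      (g ∈ nonOrthSet ρ (Projectivization.mk ℂ ψ hψ) → IsNormalizedLift ρ ψ g U) := by
  obtain ⟨U, hU⟩ := QuotientGroup.mk_surjective (ρ g)
  by_cases hg : g ∈ nonOrthSet ρ (Projectivization.mk ℂ ψ hψ)
  swap
  · exact ⟨U, hU, fun h => absurd h hg⟩
  have hUψ : U • ψ ≠ 0 := (smul_ne_zero_iff_ne U).2 hψ
  have hc : inner ℂ ψ (U • ψ) ≠ 0 := by
    intro h0
    apply hg
    rw [← hU, projUnitary_smul_mk U ψ hψ hUψ, Projectivization.submodule_mk,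
      Projectivization.submodule_mk, Submodule.isOrtho_span]
    rintro _ rfl _ rfl
    rw [← inner_conj_symm, h0, map_zero]
  set c : ℂ := inner ℂ ψ (U • ψ) with hcdef
  have hn : (‖c‖ : ℂ) ≠ 0 := by simpa using hc
  let z : Circle := ⟨(starRingEnd ℂ) c / ‖c‖, mem_sphere_zero_iff_norm.2 (by
    simp [norm_ne_zero_iff.2 hc])⟩
  have hzc : (z : ℂ) * c = (‖c‖ : ℝ) := by
    change (starRingEnd ℂ) c / ‖c‖ * c = _
    rw [div_mul_eq_mul_div, ← Complex.normSq_eq_conj_mul_self, Complex.normSq_eq_norm_sq]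
    push_cast
    field_simp
  have hmk : ((U * scalarUnitary H z : UnitaryGp H) : ProjUnitaryGp H) = ρ g := by
    rw [← hU]
    exact QuotientGroup.mk_mul_of_mem U ⟨z, rfl⟩
  have hin : inner ℂ ψ ((U * scalarUnitary H z) • ψ) = (‖c‖ : ℝ) := by
    rw [← hzc, hcdef, ← inner_smul_right]
    congr 1
    change (U : H →L[ℂ] H) ((z : ℂ) • ψ) = (z : ℂ) • (U : H →L[ℂ] H) ψ
    exact map_smul _ _ _
  refine ⟨U * scalarUnitary H z, hmk, fun _ => ⟨hmk, ?_⟩⟩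
  rw [hin]
  simpa using hc

/-- The lift `ρ_ψ(g) ∈ U(H)` of `ρ(g)`, which satisfies `⟨ψ, ρ_ψ(g) ψ⟩ > 0` if `ρ(g) [ψ]` and `[ψ]`
are not orthogonal. (For all other `g` it is an arbitrary lift of `ρ(g)`.) -/
def normalizedLift (ψ : H) (hψ : ψ ≠ 0) (g : G) : UnitaryGp H :=
  (exists_normalizedLift ρ ψ hψ g).choose

theorem coe_normalizedLift (ψ : H) (hψ : ψ ≠ 0) (g : G) :
    (normalizedLift ρ ψ hψ g : ProjUnitaryGp H) = ρ g :=
  (exists_normalizedLift ρ ψ hψ g).choose_spec.1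

/-! ### The central extension -/

/-- The group `G^♯` of all pairs `(g, U) ∈ G × U(H)` such that `U` is a lift of `ρ(g)`. -/
def GSharp : Subgroup (G × UnitaryGp H) where
  carrier := {x | ρ x.1 = (x.2 : ProjUnitaryGp H)}
  one_mem' := by
    change ρ 1 = ((1 : UnitaryGp H) : ProjUnitaryGp H)
    rw [map_one, QuotientGroup.mk_one]
  mul_mem' {a b} ha hb := by
    change ρ (a.1 * b.1) = ((a.2 * b.2 : UnitaryGp H) : ProjUnitaryGp H)
    rw [map_mul, QuotientGroup.mk_mul]
    exact congrArg₂ _ ha hb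
  inv_mem' {a} ha := by
    change ρ a.1⁻¹ = ((a.2⁻¹ : UnitaryGp H) : ProjUnitaryGp H)
    rw [map_inv, QuotientGroup.mk_inv]
    exact congrArg _ ha

/-- The projection `G^♯ → G`, `(g, U) ↦ g`. -/
def sharpProj : GSharp ρ →* G := (MonoidHom.fst G (UnitaryGp H)).comp (GSharp ρ).subtype

/-- The unitary representation `G^♯ → U(H)`, `(g, U) ↦ U`. -/
def sharpRep : GSharp ρ →* UnitaryGp H :=
  (MonoidHom.snd G (UnitaryGp H)).comp (GSharp ρ).subtype

/-- The inclusion `𝕋 → G^♯`, `z ↦ (1, z 1)`. -/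
def sharpIncl : Circle →* GSharp ρ :=
  ((MonoidHom.inr G (UnitaryGp H)).comp (scalarUnitary H)).codRestrict (GSharp ρ) fun z => by
    change ρ 1 = ((scalarUnitary H z : UnitaryGp H) : ProjUnitaryGp H)
    rw [map_one, eq_comm, QuotientGroup.eq_one_iff]
    exact ⟨z, rfl⟩

/-- The map `τ_ψ : (g, z) ↦ (g, ρ_ψ(g) z)`. -/
def sharpTriv (ψ : H) (hψ : ψ ≠ 0) (x : G × Circle) : GSharp ρ :=
  ⟨(x.1, normalizedLift ρ ψ hψ x.1 * scalarUnitary H x.2), by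
    change ρ x.1 = ((normalizedLift ρ ψ hψ x.1 * scalarUnitary H x.2 : UnitaryGp H) :
      ProjUnitaryGp H)
    rw [QuotientGroup.mk_mul_of_mem _ (⟨x.2, rfl⟩ : scalarUnitary H x.2 ∈ (scalarUnitary H).range)]
    exact (coe_normalizedLift ρ ψ hψ x.1).symm⟩

/-- The topology of `G^♯` as a subspace of `G × U(H)`, where `U(H)` carries the strong operator
topology. -/
@[reducible]
def strongTopology [TopologicalSpace G] : TopologicalSpace (GSharp ρ) :=
  TopologicalSpace.induced
    (fun γ => ((sharpProj ρ γ, fun v => sharpRep ρ γ • v) : G × (H → H))) inferInstance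

/-- `L` is a Lie group structure on `G^♯` obtained from `[ψ]`: the map `τ_ψ` is a diffeomorphism
from `U_ψ × 𝕋` onto an open subset of `G^♯`. -/
def IsAdapted (E : Type*) [AddCommGroup E] [Module ℝ E] [TopologicalSpace E]
    [TopologicalSpace G] [ChartedSpace E G] (ψ : H) (hψ : ψ ≠ 0)
    (L : LieGroupStructure (GSharp ρ)) : Prop :=
  ∃ O : Set L.Carrier, IsOpen O ∧
    IsDiffeoOn (E × CircleModel) L.Model (fun x : G × Circle => L.toCarrier (sharpTriv ρ ψ hψ x))
      (nonOrthSet ρ (Projectivization.mk ℂ ψ hψ) ×ˢ univ) O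

/-- `φ` is a smooth vector for the unitary representation of the Lie group `(G^♯, L)` on `H`. -/
def IsSmoothVector (L : LieGroupStructure (GSharp ρ)) (φ : H) : Prop :=
  SmoothMapOn L.Model H (fun γ : L.Carrier => sharpRep ρ γ • φ) univ

end Rep

end Hilbert

end

set_option linter.unusedSectionVars false

/-! ### Differential calculus in locally convex spaces -/

section Basic

variable {E F : Type*} [AddCommGroup E] [Module ℝ E] [TopologicalSpace E]
  [AddCommGroup F] [Module ℝ F] [TopologicalSpace F]

/-! A vector is determined by its ray and one nonzero scalar product: if u is the affine coordinate
of [v] at φ, then v = (⟨φ,v⟩/‖φ‖²)(φ + u). Hence a map into H whose ray varies smoothly is smooth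
wherever one matrix coefficient is smooth and nonzero (`MSmoothAt.of_ray`). Everything reduces to
finding such a coefficient.

For the normalized lift, c = ⟨ψ, ρ_ψ(g)ψ⟩ is positive and ρ_ψ(g)ψ has norm ‖ψ‖, so c = ‖ψ‖³/‖ψ + u‖
is a smooth function of the coordinate u (`mSmoothAt_normalizedLift`).

Since 𝕋 acts freely on ψ, the map γ = (g,U) ↦ (g, Uψ) is injective on G^♯. Give G^♯ the induced
topology and, as charts, left translates of τ_ψ⁻¹ followed by charts of G × 𝕋. Then a map into G^♯
is smooth once its G-component and its orbit of ψ are (`SharpLie.mSmoothAt_of`). Left translations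
are smooth because they act on the orbit by a fixed unitary. The remaining operations rest on
coefficient identities: ⟨ψ, γ⁻¹ψ⟩ is the conjugate of ⟨ψ, γψ⟩, which gives inversion over U_ψ; ⟨ψ,
γφ⟩ is the conjugate of ⟨φ, γ⁻¹ψ⟩, which gives smooth orbits of vectors φ with smooth ray and ⟨ψ,φ⟩
≠ 0, and with φ = γ₁ψ the right translations by elements over U_ψ; ⟨ψ, γδψ⟩ = ⟨γ⁻¹ψ, δψ⟩, which
gives multiplication near (1,1). Connectedness enters only in `SharpLie.mSmoothAt_mul_right`: U_ψ
generates G, so all right translations are smooth, and translation carries the local statements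
everywhere.

Every adapted structure is compared with this one model: they agree near 1 through τ_ψ, hence
everywhere by left translation (`IsAdapted.isIsoSharpLie`). Two non-orthogonal smooth rays give the
same structure because each has a smooth orbit for the other; for orthogonal rays, density supplies
an intermediate ray. The topological statement is the continuous version of the same argument,
followed by approximation in H.

The calculus underneath uses tangent maps (`CB`), for which the chain rule is an easy induction. The
delicate point is the equivalence with the definition by iterated directional derivatives
(`SmoothOnOpen.cb`), which needs their multilinearity. -/

theorem HasDirDeriv.unique [T2Space F] {f : E → F} {x h : E} {y z : F}
    (hy : HasDirDeriv f x h y) (hz : HasDirDeriv f x h z) : y = z :=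
  tendsto_nhds_unique hy hz

theorem tendsto_add_smul [IsTopologicalAddGroup E] [ContinuousSMul ℝ E] (x h : E) :
    Tendsto (fun t : ℝ => x + t • h) (𝓝 0) (𝓝 x) := by
  have : Continuous fun t : ℝ => x + t • h := by fun_prop
  simpa using this.tendsto 0

theorem HasDirDeriv.congr [IsTopologicalAddGroup E] [ContinuousSMul ℝ E] {f g : E → F}
    {x h : E} {y : F} (hf : HasDirDeriv f x h y) (hfg : f =ᶠ[𝓝 x] g) :
    HasDirDeriv g x h y := by
  refine Tendsto.congr' ?_ hf
  filter_upwards [((tendsto_add_smul x h).eventually hfg).filter_mono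
    (nhdsWithin_le_nhds (s := {0}ᶜ))] with t ht
  rw [ht, hfg.self_of_nhds]

theorem HasDirDeriv.smul_dir [ContinuousSMul ℝ F] {f : E → F} {x h : E} {y : F}
    (hf : HasDirDeriv f x h y) (c : ℝ) : HasDirDeriv f x (c • h) (c • y) := by
  -- The substitution t ↦ t * c preserves the punctured neighbourhoods of 0 only for c ≠ 0.
  rcases eq_or_ne c 0 with rfl | hc
  · simpa [HasDirDeriv] using tendsto_const_nhds
  have h1 : Tendsto (fun t : ℝ => t * c) (𝓝[≠] 0) (𝓝[≠] 0) := by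
    refine tendsto_nhdsWithin_of_tendsto_nhds_of_eventually_within _ ?_ ?_
    · have : Continuous fun t : ℝ => t * c := by fun_prop
      simpa using (this.tendsto 0).mono_left nhdsWithin_le_nhds
    · filter_upwards [self_mem_nhdsWithin] with t ht
      exact mul_ne_zero ht hc
  refine ((Tendsto.comp hf h1).const_smul c).congr fun t => ?_
  simp only [Function.comp_apply, smul_smul, mul_inv_rev]
  rw [← mul_assoc, mul_inv_cancel₀ hc, one_mul]

/-- A curve whose derivatives lie in a closed convex set has its increment in this set. -/
theorem sub_mem_of_hasDirDeriv_mem [IsTopologicalAddGroup F] [ContinuousSMul ℝ F]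
    [LocallyConvexSpace ℝ F] {γ γ' : ℝ → F} {C : Set F} (hC : Convex ℝ C) (hC' : IsClosed C)
    (hγ : ∀ s ∈ Icc (0 : ℝ) 1, HasDirDeriv γ s 1 (γ' s)) (hmem : ∀ s ∈ Icc (0 : ℝ) 1, γ' s ∈ C) :
    γ 1 - γ 0 ∈ C := by
  by_contra hcon
  -- A functional l separating the increment from C makes l ∘ γ a real function with derivative
  -- above c but increment below c, against the mean value theorem.
  obtain ⟨l, c, hl, hlC⟩ := geometric_hahn_banach_point_closed hC hC' hcon
  have hd : ∀ s ∈ Icc (0 : ℝ) 1, HasDerivAt (fun s => l (γ s)) (l (γ' s)) s := by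
    intro s hs
    rw [hasDerivAt_iff_tendsto_slope_zero]
    refine ((l.continuous.tendsto _).comp (hγ s hs)).congr fun t => ?_
    simp
  obtain ⟨s, hs, hs'⟩ := exists_hasDerivAt_eq_slope (fun s => l (γ s)) (fun s => l (γ' s))
    zero_lt_one (fun s hs => (hd s hs).continuousAt.continuousWithinAt)
    (fun s hs => hd s (Ioo_subset_Icc_self hs))
  have := hlC _ (hmem s (Ioo_subset_Icc_self hs))
  rw [map_sub] at hl
  simp only [sub_zero, div_one] at hs'
  linarith

end Basic

section LocallyConvex

variable {E : Type*} [AddCommGroup E] [Module ℝ E] [TopologicalSpace E]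
  [IsTopologicalAddGroup E] [ContinuousSMul ℝ E]
variable {F : Type*} [AddCommGroup F] [Module ℝ F] [TopologicalSpace F]
  [IsTopologicalAddGroup F] [ContinuousSMul ℝ F] [LocallyConvexSpace ℝ F]

/-- The space is regular, so a convex neighbourhood inside a closed one can be replaced by its
closure. Closedness is what Hahn–Banach separation requires. -/
theorem exists_closed_convex_nhds (y : F) {N : Set F} (hN : N ∈ 𝓝 y) :
    ∃ C ∈ 𝓝 y, Convex ℝ C ∧ IsClosed C ∧ C ⊆ N := by
  obtain ⟨N', hN', hcl, hsub⟩ := exists_mem_nhds_isClosed_subset hN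
  obtain ⟨C, ⟨hC, hconv⟩, hCN⟩ := (LocallyConvexSpace.convex_basis (𝕜 := ℝ) y).mem_iff.1 hN'
  exact ⟨closure C, mem_of_superset hC subset_closure, hconv.closure, isClosed_closure,
    (closure_minimal hCN hcl).trans hsub⟩

/-- Difference quotients of a function with continuous directional derivatives converge jointly. -/
theorem tendsto_diffQuotient {f : E → F} {df : E × E → F} {U : Set E} (hU : IsOpen U)
    (hf : ∀ x ∈ U, ∀ h, HasDirDeriv f x h (df (x, h))) (hdf : ContinuousOn df (U ×ˢ univ))
    {x : E} (hx : x ∈ U) (h : E) :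
    Tendsto (fun p : (E × E) × ℝ => p.2⁻¹ • (f (p.1.1 + p.2 • p.1.2) - f p.1.1))
      (𝓝 (x, h) ×ˢ 𝓝[≠] 0) (𝓝 (df (x, h))) := by
  intro N hN
  obtain ⟨C, hC, hconv, hcl, hCN⟩ := exists_closed_convex_nhds _ hN
  have hcont : Continuous fun p : (E × E) × ℝ => (p.1.1 + p.2 • p.1.2, p.1.2) := by fun_prop
  have hUo : U ×ˢ (univ : Set E) ∈ 𝓝 (x, h) :=
    (hU.prod isOpen_univ).mem_nhds ⟨hx, mem_univ _⟩
  have h1 : Tendsto (fun p : (E × E) × ℝ => (p.1.1 + p.2 • p.1.2, p.1.2)) (𝓝 (x, h) ×ˢ 𝓝 0)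
      (𝓝 (x, h)) := by
    have := hcont.tendsto ((x, h), 0)
    rwa [nhds_prod_eq, zero_smul, add_zero] at this
  have h2 := h1.eventually ((hdf.continuousAt hUo).eventually hC |>.and hUo)
  rw [((𝓝 (x, h)).basis_sets.prod Metric.nhds_basis_ball).eventually_iff] at h2
  obtain ⟨⟨A, δ⟩, ⟨hA, hδ⟩, h2⟩ := h2
  have h3 : A ×ˢ (Metric.ball (0 : ℝ) δ ∩ {0}ᶜ) ∈ 𝓝 (x, h) ×ˢ 𝓝[≠] (0 : ℝ) :=
    prod_mem_prod hA (inter_mem (mem_nhdsWithin_of_mem_nhds (Metric.ball_mem_nhds 0 hδ))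
      self_mem_nhdsWithin)
  rw [mem_map]
  filter_upwards [h3]
  rintro ⟨⟨x', h'⟩, t⟩ ⟨hxA, ht, ht0⟩
  have ht0 : t ≠ 0 := ht0
  -- The ball of radius δ is stable under multiplication by s ∈ [0,1], so the estimate holds along
  -- the whole segment from x' to x' + t h'.
  have hseg : ∀ s ∈ Icc (0 : ℝ) 1, df (x' + (s * t) • h', h') ∈ C ∧ x' + (s * t) • h' ∈ U := by
    intro s hs
    have hst : s * t ∈ Metric.ball (0 : ℝ) δ := by
      rw [mem_ball_zero_iff, norm_mul, Real.norm_of_nonneg hs.1] at *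
      exact (mul_le_of_le_one_left (norm_nonneg _) hs.2).trans_lt ht
    have := @h2 ((x', h'), s * t) ⟨hxA, hst⟩
    exact ⟨this.1, this.2.1⟩
  refine mem_preimage.2 (hCN ?_)
  -- The difference quotient is the increment over [0,1] of s ↦ t⁻¹ f(x' + s t h'), whose derivative
  -- is `df` along the segment.
  have key := sub_mem_of_hasDirDeriv_mem (γ := fun s => t⁻¹ • f (x' + (s * t) • h'))
    (γ' := fun s => df (x' + (s * t) • h', h')) hconv hcl (fun s hs => ?_)
    (fun s hs => (hseg s hs).1)
  · simpa [smul_sub] using key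
  · have := (hf _ (hseg s hs).2 h').smul_dir t
    have h5 := ((tendsto_const_nhds (x := t⁻¹)).smul this)
    rw [smul_smul, inv_mul_cancel₀ ht0, one_smul] at h5
    refine h5.congr fun r => ?_
    have e : x' + ((s + r • 1) * t) • h' = x' + (s * t) • h' + r • t • h' := by
      rw [smul_eq_mul, mul_one, add_mul, add_smul, smul_smul, add_assoc]
    rw [smul_comm, smul_sub]
    simp only [e, smul_sub]

/-- The quotient for g ∘ f is a quotient of g at f x in the moving direction t⁻¹(f(x + t h) - f x),
which tends to y. Joint convergence of difference quotients absorbs the moving direction. -/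
theorem HasDirDeriv.comp {Z : Type*} [AddCommGroup Z] [Module ℝ Z]
    [TopologicalSpace Z] [IsTopologicalAddGroup Z] [ContinuousSMul ℝ Z] [LocallyConvexSpace ℝ Z]
    {f : E → F} {g : F → Z} {dg : F × F → Z} {V : Set F} (hV : IsOpen V)
    (hg : ∀ x ∈ V, ∀ h, HasDirDeriv g x h (dg (x, h))) (hdg : ContinuousOn dg (V ×ˢ univ))
    {x h : E} {y : F} (hx : f x ∈ V) (hf : HasDirDeriv f x h y) :
    HasDirDeriv (fun x => g (f x)) x h (dg (f x, y)) := by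
  have h1 : Tendsto (fun t : ℝ => ((f x, t⁻¹ • (f (x + t • h) - f x)), t)) (𝓝[≠] 0)
      (𝓝 (f x, y) ×ˢ 𝓝[≠] 0) := by
    rw [nhds_prod_eq]
    exact (tendsto_const_nhds.prodMk hf).prodMk tendsto_id
  refine ((tendsto_diffQuotient hV hg hdg hx y).comp h1).congr' ?_
  filter_upwards [self_mem_nhdsWithin] with t ht
  have ht : t ≠ 0 := ht
  simp [smul_smul, ht]

/-- Continuous directional derivatives are additive in the direction. -/
theorem HasDirDeriv.map_add [T2Space F] {f : E → F} {df : E × E → F} {U : Set E} (hU : IsOpen U)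
    (hf : ∀ x ∈ U, ∀ h, HasDirDeriv f x h (df (x, h))) (hdf : ContinuousOn df (U ×ˢ univ))
    {x : E} (hx : x ∈ U) (h k : E) : df (x, h + k) = df (x, h) + df (x, k) := by
  have h1 : Tendsto (fun t : ℝ => ((x + t • h, k), t)) (𝓝[≠] 0) (𝓝 (x, k) ×ˢ 𝓝[≠] 0) := by
    rw [nhds_prod_eq]
    exact (((tendsto_add_smul x h).mono_left nhdsWithin_le_nhds).prodMk
      tendsto_const_nhds).prodMk tendsto_id
  -- Go from x to x + t h and then by t k. The second step has a moving base point, which joint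
  -- convergence allows.
  refine (hf x hx (h + k)).unique (((hf x hx h).add
    ((tendsto_diffQuotient hU hf hdf hx k).comp h1)).congr fun t => ?_)
  rw [Function.comp_apply, ← smul_add, smul_add t h k, ← add_assoc]
  congr 1
  abel

end LocallyConvex

/-! ### Iterated differentiability -/

section CB

/-- The directional derivative (with junk value `0`). -/
noncomputable def dirD {E : Type u} {F : Type v} [AddCommGroup E] [Module ℝ E] [TopologicalSpace E]
    [AddCommGroup F] [Module ℝ F] [TopologicalSpace F] (f : E → F) (p : E × E) : F :=
  open Classical in if h : ∃ y, HasDirDeriv f p.1 p.2 y then h.choose else 0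

/-- `f` is `n` times continuously differentiable on `U` in the sense of Michal and Bastiani,
defined by recursion on `n` by means of the tangent map. -/
def CB {F : Type v} [AddCommGroup F] [Module ℝ F] [TopologicalSpace F] :
    ℕ → ∀ {E : Type u} [AddCommGroup E] [Module ℝ E] [TopologicalSpace E], (E → F) → Set E → Prop
  | 0, _, _, _, _, f, U => ContinuousOn f U
  | n + 1, _, _, _, _, f, U => ContinuousOn f U ∧
      (∀ x ∈ U, ∀ h, ∃ y, HasDirDeriv f x h y) ∧ CB n (dirD f) (U ×ˢ univ)

variable {F : Type v} [AddCommGroup F] [Module ℝ F] [TopologicalSpace F]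
  [IsTopologicalAddGroup F] [ContinuousSMul ℝ F] [LocallyConvexSpace ℝ F] [T2Space F]

theorem CB.continuousOn {E : Type u} [AddCommGroup E] [Module ℝ E] [TopologicalSpace E]
    {n : ℕ} {f : E → F} {U : Set E} (h : CB n f U) : ContinuousOn f U := by
  cases n with
  | zero => exact h
  | succ n => exact h.1

theorem HasDirDeriv.dirD_eq {E : Type u} [AddCommGroup E] [Module ℝ E] [TopologicalSpace E]
    {f : E → F} {x h : E} {y : F} (hy : HasDirDeriv f x h y) : dirD f (x, h) = y := by
  have : ∃ y, HasDirDeriv f (x, h).1 (x, h).2 y := ⟨y, hy⟩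
  rw [dirD, dif_pos this]
  exact this.choose_spec.unique hy

theorem CB.hasDirDeriv {E : Type u} [AddCommGroup E] [Module ℝ E] [TopologicalSpace E]
    {n : ℕ} {f : E → F} {U : Set E} (hf : CB (n + 1) f U) {x : E} (hx : x ∈ U) (h : E) :
    HasDirDeriv f x h (dirD f (x, h)) := by
  obtain ⟨y, hy⟩ := hf.2.1 x hx h
  rwa [hy.dirD_eq]

theorem CB.mono {n : ℕ} : ∀ {E : Type u} [AddCommGroup E] [Module ℝ E] [TopologicalSpace E]
    {f : E → F} {U V : Set E}, CB n f U → V ⊆ U → CB n f V := by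
  induction n with
  | zero => exact fun hf hV => ContinuousOn.mono hf hV
  | succ n ih => exact fun hf hV => ⟨hf.1.mono hV, fun x hx => hf.2.1 x (hV hx),
      ih hf.2.2 (prod_mono_left hV)⟩

theorem CB.of_succ {n : ℕ} : ∀ {E : Type u} [AddCommGroup E] [Module ℝ E] [TopologicalSpace E]
    {f : E → F} {U : Set E}, CB (n + 1) f U → CB n f U := by
  induction n with
  | zero => exact fun hf => hf.1
  | succ n ih => exact fun hf => ⟨hf.1, hf.2.1, ih hf.2.2⟩

theorem CB.congr {n : ℕ} : ∀ {E : Type u} [AddCommGroup E] [Module ℝ E] [TopologicalSpace E]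
    [IsTopologicalAddGroup E] [ContinuousSMul ℝ E]
    {f g : E → F} {U : Set E}, IsOpen U → CB n f U → EqOn f g U → CB n g U := by
  induction n with
  | zero => exact fun _ hf hfg => ContinuousOn.congr hf hfg.symm
  | succ n ih =>
    intro E _ _ _ _ _ f g U hU hf hfg
    have key : ∀ x ∈ U, ∀ h, HasDirDeriv g x h (dirD f (x, h)) := fun x hx h =>
      (hf.hasDirDeriv hx h).congr (hfg.eventuallyEq_of_mem (hU.mem_nhds hx))
    exact ⟨hf.1.congr hfg.symm, fun x hx h => ⟨_, key x hx h⟩,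
      ih (hU.prod isOpen_univ) hf.2.2 fun p hp => (key p.1 hp.1 p.2).dirD_eq.symm⟩

/-- Introduction rule: any candidate for the tangent map may be used. -/
theorem CB.succ_of {E : Type u} [AddCommGroup E] [Module ℝ E] [TopologicalSpace E]
    [IsTopologicalAddGroup E] [ContinuousSMul ℝ E] {n : ℕ} {f : E → F} {df : E × E → F} {U : Set E}
    (hU : IsOpen U) (hc : ContinuousOn f U) (hf : ∀ x ∈ U, ∀ h, HasDirDeriv f x h (df (x, h)))
    (hdf : CB n df (U ×ˢ univ)) : CB (n + 1) f U :=
  ⟨hc, fun x hx h => ⟨_, hf x hx h⟩,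
    hdf.congr (hU.prod isOpen_univ) fun p hp => (hf p.1 hp.1 p.2).dirD_eq.symm⟩

theorem CB.of_locally {n : ℕ} : ∀ {E : Type u} [AddCommGroup E] [Module ℝ E] [TopologicalSpace E]
    {f : E → F} {U : Set E}, (∀ x ∈ U, ∃ V, IsOpen V ∧ x ∈ V ∧ CB n f V) → CB n f U := by
  induction n with
  | zero =>
    intro E _ _ _ f U h x hx
    obtain ⟨V, hV, hxV, hf⟩ := h x hx
    exact (ContinuousOn.continuousAt hf (hV.mem_nhds hxV)).continuousWithinAt
  | succ n ih =>
    intro E _ _ _ f U h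
    refine ⟨fun x hx => ?_, fun x hx => ?_, ih fun p hp => ?_⟩
    · obtain ⟨V, hV, hxV, hf⟩ := h x hx
      exact (hf.1.continuousAt (hV.mem_nhds hxV)).continuousWithinAt
    · obtain ⟨V, hV, hxV, hf⟩ := h x hx
      exact hf.2.1 x hxV
    · obtain ⟨V, hV, hxV, hf⟩ := h p.1 hp.1
      exact ⟨V ×ˢ univ, hV.prod isOpen_univ, ⟨hxV, mem_univ _⟩, hf.2.2⟩

/-- The tangent map of f ∘ L is that of f composed with L × L. This comes before the general chain
rule, whose induction precomposes with a projection. -/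
theorem CB.comp_clm {n : ℕ} : ∀ {E E' : Type u} [AddCommGroup E] [Module ℝ E] [TopologicalSpace E]
    [AddCommGroup E'] [Module ℝ E'] [TopologicalSpace E'] [IsTopologicalAddGroup E']
    [ContinuousSMul ℝ E'] {f : E → F} {U : Set E} (_ : IsOpen U) (_ : CB n f U) (L : E' →L[ℝ] E),
    CB n (fun x => f (L x)) (L ⁻¹' U) := by
  induction n with
  | zero => exact fun _ hf L => ContinuousOn.comp hf L.continuous.continuousOn (mapsTo_preimage _ _)
  | succ n ih =>
    intro E E' _ _ _ _ _ _ _ _ f U hU hf L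
    refine CB.succ_of (df := fun p => dirD f (L.prodMap L p)) (hU.preimage L.continuous)
      (hf.1.comp L.continuous.continuousOn (mapsTo_preimage _ _)) (fun x hx h => ?_) ?_
    · simpa [HasDirDeriv] using hf.hasDirDeriv hx (L h)
    · exact ih (hU.prod isOpen_univ) hf.2.2 (L.prodMap L)

theorem CB.clm_comp {Z : Type*} [AddCommGroup Z] [Module ℝ Z] [TopologicalSpace Z]
    [IsTopologicalAddGroup Z] [ContinuousSMul ℝ Z] [LocallyConvexSpace ℝ Z] [T2Space Z]
    (L : F →L[ℝ] Z) {n : ℕ} :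
    ∀ {E : Type u} [AddCommGroup E] [Module ℝ E] [TopologicalSpace E] [IsTopologicalAddGroup E]
    [ContinuousSMul ℝ E] {f : E → F} {U : Set E} (_ : IsOpen U) (_ : CB n f U),
    CB n (fun x => L (f x)) U := by
  induction n with
  | zero => exact fun _ hf => L.continuous.comp_continuousOn hf
  | succ n ih =>
    intro E _ _ _ _ _ f U hU hf
    refine CB.succ_of (df := fun p => L (dirD f p)) hU (L.continuous.comp_continuousOn hf.1)
      (fun x hx h => ?_) (ih (hU.prod isOpen_univ) hf.2.2)
    simpa [HasDirDeriv, Function.comp_def] using (L.continuous.tendsto _).comp (hf.hasDirDeriv hx h)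

theorem CB.prodMk {Z : Type*} [AddCommGroup Z] [Module ℝ Z] [TopologicalSpace Z]
    [IsTopologicalAddGroup Z] [ContinuousSMul ℝ Z] [LocallyConvexSpace ℝ Z] [T2Space Z] {n : ℕ} :
    ∀ {E : Type u} [AddCommGroup E] [Module ℝ E] [TopologicalSpace E] [IsTopologicalAddGroup E]
    [ContinuousSMul ℝ E] {f : E → F} {g : E → Z} {U : Set E} (_ : IsOpen U) (_ : CB n f U)
    (_ : CB n g U), CB n (fun x => (f x, g x)) U := by
  induction n with
  | zero => exact fun _ hf hg => ContinuousOn.prodMk hf hg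
  | succ n ih =>
    intro E _ _ _ _ _ f g U hU hf hg
    refine CB.succ_of (df := fun p => (dirD f p, dirD g p)) hU (hf.1.prodMk hg.1)
      (fun x hx h => ?_) (ih (hU.prod isOpen_univ) hf.2.2 hg.2.2)
    exact (hf.hasDirDeriv hx h).prodMk_nhds (hg.hasDirDeriv hx h)

theorem CB.const {n : ℕ} (c : F) : ∀ {E : Type u} [AddCommGroup E] [Module ℝ E]
    [TopologicalSpace E] [IsTopologicalAddGroup E] [ContinuousSMul ℝ E] {U : Set E} (_ : IsOpen U),
    CB n (fun _ : E => c) U := by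
  induction n generalizing c with
  | zero => exact fun _ => continuousOn_const
  | succ n ih =>
    intro E _ _ _ _ _ U hU
    refine CB.succ_of (df := fun _ => 0) hU continuousOn_const (fun x hx h => ?_)
      (ih 0 (hU.prod isOpen_univ))
    simp [HasDirDeriv]

theorem CB.clm {n : ℕ} : ∀ {E : Type u} [AddCommGroup E] [Module ℝ E]
    [TopologicalSpace E] [IsTopologicalAddGroup E] [ContinuousSMul ℝ E] {U : Set E} (_ : IsOpen U)
    (L : E →L[ℝ] F), CB n (fun x => L x) U := by
  induction n with
  | zero => exact fun _ L => L.continuous.continuousOn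
  | succ n ih =>
    intro E _ _ _ _ _ U hU L
    refine CB.succ_of (df := fun p => L p.2) hU L.continuous.continuousOn (fun x hx h => ?_)
      (ih (hU.prod isOpen_univ) (L.comp (ContinuousLinearMap.snd ℝ E E)))
    refine tendsto_const_nhds.congr' ?_
    filter_upwards [self_mem_nhdsWithin] with t ht
    have ht : t ≠ 0 := ht
    simp [smul_smul, ht]

/-- The derivative of g ∘ f is the derivative of g composed with (f ∘ pr₁, df). Both factors are
again `CB n`, now on product spaces, so the induction must leave the spaces free. -/
theorem CB.comp {Z : Type*} [AddCommGroup Z] [Module ℝ Z] [TopologicalSpace Z]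
    [IsTopologicalAddGroup Z] [ContinuousSMul ℝ Z] [LocallyConvexSpace ℝ Z] [T2Space Z] {n : ℕ} :
    ∀ {E : Type u} [AddCommGroup E] [Module ℝ E] [TopologicalSpace E] [IsTopologicalAddGroup E]
    [ContinuousSMul ℝ E] {F : Type v} [AddCommGroup F] [Module ℝ F] [TopologicalSpace F]
    [IsTopologicalAddGroup F] [ContinuousSMul ℝ F] [LocallyConvexSpace ℝ F] [T2Space F]
    {f : E → F} {g : F → Z} {U : Set E} {V : Set F}
    (_ : IsOpen U) (_ : IsOpen V) (_ : CB n g V) (_ : CB n f U) (_ : MapsTo f U V),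
    CB n (fun x => g (f x)) U := by
  induction n with
  | zero => exact fun _ _ hg hf hm => ContinuousOn.comp hg hf hm
  | succ n ih =>
    intro E _ _ _ _ _ F _ _ _ _ _ _ _ f g U V hU hV hg hf hm
    refine CB.succ_of (df := fun p => dirD g (f p.1, dirD f p)) hU (hg.1.comp hf.1 hm)
      (fun x hx h => ?_) ?_
    · exact HasDirDeriv.comp hV (fun x hx h => hg.hasDirDeriv hx h) hg.2.2.continuousOn (hm hx)
        (hf.hasDirDeriv hx h)
    · refine ih (hU.prod isOpen_univ) (hV.prod isOpen_univ) hg.2.2 (CB.prodMk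
        (hU.prod isOpen_univ) ?_ hf.2.2) (fun p hp => ⟨hm hp.1, mem_univ _⟩)
      refine CB.mono (CB.comp_clm hU hf.of_succ (ContinuousLinearMap.fst ℝ E E)) ?_
      exact fun p hp => hp.1

theorem CB.sum {ι : Type*} {E : Type u} [AddCommGroup E] [Module ℝ E] [TopologicalSpace E]
    [IsTopologicalAddGroup E] [ContinuousSMul ℝ E] {n : ℕ} {f : ι → E → F} {U : Set E}
    (hU : IsOpen U) (s : Finset ι) (h : ∀ i ∈ s, CB n (f i) U) :
    CB n (fun x => ∑ i ∈ s, f i x) U := by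
  classical
  induction s using Finset.induction_on with
  | empty => simpa using CB.const 0 hU
  | insert i s hi ih =>
    simp only [Finset.sum_insert hi]
    exact CB.clm_comp (ContinuousLinearMap.fst ℝ F F + ContinuousLinearMap.snd ℝ F F) hU
      (CB.prodMk hU (h i (Finset.mem_insert_self _ _))
        (ih fun j hj => h j (Finset.mem_insert_of_mem hj)))

/-! ### Comparison with smooth maps -/

variable {E : Type u} [AddCommGroup E] [Module ℝ E] [TopologicalSpace E]
  [IsTopologicalAddGroup E] [ContinuousSMul ℝ E]

/-- The iterated derivatives are built by differentiating in the last listed direction with the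
others frozen. Jointly in (x, h), each is the tangent map of the previous one composed with a linear
map, so it inherits all orders of differentiability. -/
theorem CB.smoothOnOpen {f : E → F} {U : Set E} (hU : IsOpen U) (hf : ∀ n, CB n f U) :
    SmoothOnOpen f U := by
  let D : (j : ℕ) → E → (Fin j → E) → F := fun j => Nat.rec (motive := fun j => E → (Fin j → E) → F)
    (fun x _ => f x) (fun j Dj x h => dirD (fun y => Dj y (Fin.init h)) (x, h (Fin.last j))) j
  have hDs : ∀ j x h, D (j + 1) x h = dirD (fun y => D j y (Fin.init h)) (x, h (Fin.last j)) :=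
    fun _ _ _ => rfl
  have key : ∀ j n, CB n (fun p : E × (Fin j → E) => D j p.1 p.2) (U ×ˢ univ) := by
    intro j
    induction j with
    | zero =>
      intro n
      exact (CB.comp_clm hU (hf n) (ContinuousLinearMap.fst ℝ E (Fin 0 → E))).mono fun p hp => hp.1
    | succ j ih =>
      intro n
      -- Base point (x, h₁, …, h_j) and direction (h_{j+1}, 0): the zero freezes the earlier
      -- directions.
      let L : E × (Fin (j + 1) → E) →L[ℝ] (E × (Fin j → E)) × (E × (Fin j → E)) :=
        ((ContinuousLinearMap.fst ℝ _ _).prod ((ContinuousLinearMap.pi fun i =>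
          ContinuousLinearMap.proj (R := ℝ) (φ := fun _ : Fin (j + 1) => E) i.castSucc).comp
            (ContinuousLinearMap.snd ℝ _ _))).prod
          (((ContinuousLinearMap.proj (R := ℝ) (φ := fun _ : Fin (j + 1) => E) (Fin.last j)).comp
            (ContinuousLinearMap.snd ℝ _ _)).prod 0)
      refine CB.congr (hU.prod isOpen_univ) (CB.mono (CB.comp_clm
        ((hU.prod isOpen_univ).prod isOpen_univ) (ih (n + 1)).2.2 L) fun p hp =>
          ⟨⟨hp.1, mem_univ _⟩, mem_univ _⟩) fun p hp => ?_
      have := (ih 1).hasDirDeriv (x := (p.1, Fin.init p.2)) ⟨hp.1, mem_univ _⟩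
        (p.2 (Fin.last j), 0)
      have h2 : HasDirDeriv (fun y => D j y (Fin.init p.2)) p.1 (p.2 (Fin.last j))
        (dirD (fun p : E × (Fin j → E) => D j p.1 p.2)
          ((p.1, Fin.init p.2), (p.2 (Fin.last j), 0))) := by
        simpa [HasDirDeriv] using this
      rw [hDs, h2.dirD_eq]
      rfl
  refine ⟨D, fun _ _ _ => rfl, fun j x hx h v => ?_, fun j => key j 0⟩
  rw [hDs, Fin.init_snoc, Fin.snoc_last]
  have := (key j 1).hasDirDeriv (x := (x, h)) ⟨hx, mem_univ _⟩ (v, 0)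
  have h2 : HasDirDeriv (fun y => D j y h) x v
      (dirD (fun p : E × (Fin j → E) => D j p.1 p.2) ((x, h), (v, 0))) := by
    simpa [HasDirDeriv] using this
  rwa [h2.dirD_eq]

/-- The hypothesis differentiates D^j only in x with h fixed. Multilinearity in h gives the full
derivative of D^j at (x,h) along (v,w): D^{j+1}(x; h, v) plus the sum over i of D^j with h_i
replaced by w_i. This again consists of D's composed with linear maps, so one inducts on the order
for all j at once. -/
theorem SmoothOnOpen.cb {f : E → F} {U : Set E} (hU : IsOpen U) (hf : SmoothOnOpen f U) (n : ℕ) :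
    CB n f U := by
  classical
  obtain ⟨D, hD0, hDs, hDc⟩ := hf
  have hdf : ∀ j (h : Fin j → E), ContinuousOn
      (fun p : E × E => D (j + 1) p.1 (Fin.snoc h p.2)) (U ×ˢ univ) := by
    intro j h
    have hc : Continuous fun p : E × E => (p.1, (Fin.snoc h p.2 : Fin (j + 1) → E)) :=
      continuous_fst.prodMk (Continuous.finSnoc continuous_const continuous_snd)
    exact (hDc (j + 1)).comp hc.continuousOn fun p hp => ⟨hp.1, mem_univ _⟩
  -- multilinearity of the derivatives
  have hadd : ∀ j, ∀ x ∈ U, ∀ (h : Fin j → E) i a b, D j x (Function.update h i (a + b)) =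
      D j x (Function.update h i a) + D j x (Function.update h i b) := by
    intro j
    induction j with
    | zero => exact fun _ _ _ i => i.elim0
    | succ j ih =>
      intro x hx h i a b
      rw [← Fin.snoc_init_self h]
      refine Fin.lastCases ?_ (fun i => ?_) i
      · simp only [Fin.update_snoc_last]
        exact HasDirDeriv.map_add (df := fun p => D (j + 1) p.1 (Fin.snoc (Fin.init h) p.2)) hU
          (fun y hy k => hDs j y hy _ k) (hdf j _) hx a b
      -- In the earlier slots additivity holds for D^j by induction and passes to the limit of
      -- difference quotients; the last slot is additivity of the derivative in its direction.
      · simp only [← Fin.snoc_update]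
        refine (hDs j x hx _ _).unique (((hDs j x hx _ _).add (hDs j x hx _ _)).congr' ?_)
        have := (tendsto_add_smul x (h (Fin.last j))).eventually (hU.mem_nhds hx)
        filter_upwards [this.filter_mono (nhdsWithin_le_nhds (s := {0}ᶜ))] with t ht
        rw [ih x hx, ih _ ht, ← smul_add]
        congr 1
        abel
  have hsmul : ∀ j, ∀ x ∈ U, ∀ (h : Fin j → E) i (c : ℝ) a, D j x (Function.update h i (c • a)) =
      c • D j x (Function.update h i a) := by
    intro j
    induction j with
    | zero => exact fun _ _ _ i => i.elim0
    | succ j ih =>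
      intro x hx h i c a
      rw [← Fin.snoc_init_self h]
      refine Fin.lastCases ?_ (fun i => ?_) i
      · simp only [Fin.update_snoc_last]
        exact (hDs j x hx _ _).unique ((hDs j x hx _ _).smul_dir c)
      · simp only [← Fin.snoc_update]
        refine (hDs j x hx _ _).unique (((hDs j x hx _ _).const_smul c).congr' ?_)
        have := (tendsto_add_smul x (h (Fin.last j))).eventually (hU.mem_nhds hx)
        filter_upwards [this.filter_mono (nhdsWithin_le_nhds (s := {0}ᶜ))] with t ht
        rw [ih x hx, ih _ ht, ← smul_sub, smul_comm]
  have hmain : ∀ j, ∀ x ∈ U, ∀ (h : Fin j → E) v (w : Fin j → E),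
      HasDirDeriv (fun p : E × (Fin j → E) => D j p.1 p.2) (x, h) (v, w)
        (D (j + 1) x (Fin.snoc h v) + ∑ i, D j x (Function.update h i (w i))) := by
    intro j x hx h v w
    -- Switch on the components of w one at a time. By linearity in slot i, the step adding i
    -- contributes exactly D^j with w_i in that slot, and continuity of D^j gives its limit.
    have hS : ∀ S : Finset (Fin j), Tendsto (fun t : ℝ => t⁻¹ •
        (D j (x + t • v) (h + t • fun i => if i ∈ S then w i else 0) - D j (x + t • v) h))
        (𝓝[≠] 0) (𝓝 (∑ i ∈ S, D j x (Function.update h i (w i)))) := by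
      intro S
      induction S using Finset.induction_on with
      | empty =>
        have : (fun _ : Fin j => (0 : E)) = 0 := rfl
        simp [this]
      | insert i S hi ih =>
        rw [Finset.sum_insert hi]
        have hcont : Tendsto (fun t : ℝ => D j (x + t • v)
            (Function.update (h + t • fun i => if i ∈ S then w i else 0) i (w i))) (𝓝[≠] 0)
            (𝓝 (D j x (Function.update h i (w i)))) := by
          have h1 : Tendsto (fun t : ℝ => (x + t • v,
              Function.update (h + t • fun i => if i ∈ S then w i else 0) i (w i))) (𝓝 0)
              (𝓝 (x, Function.update h i (w i))) := by
            refine (tendsto_add_smul x v).prodMk_nhds ?_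
            exact (tendsto_add_smul h fun i => if i ∈ S then w i else 0).update i tendsto_const_nhds
          exact (((hDc j).continuousAt ((hU.prod isOpen_univ).mem_nhds
            ⟨hx, mem_univ _⟩)).tendsto.comp h1).mono_left nhdsWithin_le_nhds
        refine (hcont.add ih).congr' ?_
        have := (tendsto_add_smul x v).eventually (hU.mem_nhds hx)
        filter_upwards [this.filter_mono (nhdsWithin_le_nhds (s := {0}ᶜ)), self_mem_nhdsWithin]
          with t ht ht0
        have ht0 : t ≠ 0 := ht0
        have e : (h + t • fun k => if k ∈ insert i S then w k else 0) = Function.update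
            (h + t • fun k => if k ∈ S then w k else 0) i (h i + t • w i) := by
          ext k
          rcases eq_or_ne k i with rfl | hk
          · simp
          · simp [hk]
        have e' : Function.update (h + t • fun k => if k ∈ S then w k else 0) i (h i) =
            h + t • fun k => if k ∈ S then w k else 0 := by
          rw [Function.update_eq_self_iff]
          simp [hi]
        rw [e, hadd j _ ht, e', hsmul j _ ht, smul_sub, smul_sub, smul_add, smul_smul,
          inv_mul_cancel₀ ht0, one_smul]
        abel
    -- Move x first with h fixed, then h at the moved point x + t v.
    refine ((hDs j x hx h v).add (hS Finset.univ)).congr fun t => ?_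
    have : (fun i : Fin j => if i ∈ Finset.univ then w i else 0) = w := by ext; simp
    rw [this, ← smul_add]
    simp
  have key : ∀ n j, CB n (fun p : E × (Fin j → E) => D j p.1 p.2) (U ×ˢ univ) := by
    intro n
    induction n with
    | zero => exact fun j => hDc j
    | succ n ih =>
      intro j
      have hO : IsOpen ((U ×ˢ (univ : Set (Fin j → E))) ×ˢ (univ : Set (E × (Fin j → E)))) :=
        (hU.prod isOpen_univ).prod isOpen_univ
      refine CB.succ_of (df := fun q : (E × (Fin j → E)) × (E × (Fin j → E)) =>
        D (j + 1) q.1.1 (Fin.snoc q.1.2 q.2.1) +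
          ∑ i, D j q.1.1 (Function.update q.1.2 i (q.2.2 i))) (hU.prod isOpen_univ) (hDc j)
        (fun x hx h => hmain j x.1 hx.1 x.2 h.1 h.2) ?_
      let P (i : Fin j) := ContinuousLinearMap.proj (R := ℝ) (φ := fun _ : Fin j => E) i
      let A := (ContinuousLinearMap.fst ℝ (E × (Fin j → E)) (E × (Fin j → E)))
      let B := (ContinuousLinearMap.snd ℝ (E × (Fin j → E)) (E × (Fin j → E)))
      let p₁ := (ContinuousLinearMap.fst ℝ E (Fin j → E))
      let p₂ := (ContinuousLinearMap.snd ℝ E (Fin j → E))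
      let L₁ : (E × (Fin j → E)) × (E × (Fin j → E)) →L[ℝ] E × (Fin (j + 1) → E) :=
        (p₁.comp A).prod (ContinuousLinearMap.pi (Fin.snoc (α := fun _ =>
          (E × (Fin j → E)) × (E × (Fin j → E)) →L[ℝ] E) (fun i => (P i).comp (p₂.comp A))
          (p₁.comp B)))
      let L₂ (i : Fin j) : (E × (Fin j → E)) × (E × (Fin j → E)) →L[ℝ] E × (Fin j → E) :=
        (p₁.comp A).prod (ContinuousLinearMap.pi (Function.update (fun k => (P k).comp (p₂.comp A))
          i ((P i).comp (p₂.comp B))))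
      have h1 : CB n (fun q : (E × (Fin j → E)) × (E × (Fin j → E)) =>
          D (j + 1) q.1.1 (Fin.snoc q.1.2 q.2.1)) ((U ×ˢ univ) ×ˢ univ) := by
        refine CB.congr hO ((CB.comp_clm (hU.prod isOpen_univ) (ih (j + 1)) L₁).mono
          fun q hq => ⟨hq.1.1, mem_univ _⟩) fun q hq => ?_
        change D (j + 1) q.1.1 _ = _
        congr 1
        ext i
        refine Fin.lastCases ?_ (fun i => ?_) i
        · simp [L₁, p₁, B]
        · simp [L₁, p₂, A, P]
      have h2 : ∀ i, CB n (fun q : (E × (Fin j → E)) × (E × (Fin j → E)) =>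
          D j q.1.1 (Function.update q.1.2 i (q.2.2 i))) ((U ×ˢ univ) ×ˢ univ) := by
        intro i
        refine CB.congr hO ((CB.comp_clm (hU.prod isOpen_univ) (ih j) (L₂ i)).mono
          fun q hq => ⟨hq.1.1, mem_univ _⟩) fun q hq => ?_
        change D j q.1.1 _ = _
        congr 1
        ext k
        rcases eq_or_ne k i with rfl | hk
        · simp [L₂, p₂, B, P]
        · simp [L₂, p₂, A, P, hk]
      exact CB.clm_comp (ContinuousLinearMap.fst ℝ F F + ContinuousLinearMap.snd ℝ F F) hO
        (CB.prodMk hO h1 (CB.sum hO Finset.univ fun i _ => h2 i))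
  let L : E →L[ℝ] E × (Fin 0 → E) := (ContinuousLinearMap.id ℝ E).prod 0
  exact CB.congr hU ((CB.comp_clm (hU.prod isOpen_univ) (key n 0) L).mono
    fun x hx => ⟨hx, mem_univ _⟩) fun x hx => hD0 x hx _

end CB

/-- Smooth maps between normed spaces. -/
theorem ContDiffOn.cb {n : ℕ} : ∀ {E : Type u} [NormedAddCommGroup E] [NormedSpace ℝ E]
    {F : Type v} [NormedAddCommGroup F] [NormedSpace ℝ F] {f : E → F} {U : Set E},
    IsOpen U → ContDiffOn ℝ n f U → CB n f U := by
  induction n with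
  | zero => exact fun _ hf => hf.continuousOn
  | succ n ih =>
    intro E _ _ F _ _ f U hU hf
    refine CB.succ_of (df := fun p => fderiv ℝ f p.1 p.2) hU hf.continuousOn (fun x hx h => ?_) ?_
    · have h1 : HasFDerivAt f (fderiv ℝ f x) x :=
        ((hf.differentiableOn (by simp)).differentiableAt (hU.mem_nhds hx)).hasFDerivAt
      have h2 : HasDerivAt (fun t : ℝ => f (x + t • h)) (fderiv ℝ f x h) 0 := by
        have h3 : HasDerivAt (fun t : ℝ => x + t • h) h 0 := by
          simpa using ((hasDerivAt_id (0 : ℝ)).smul_const h).const_add x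
        have h1 : HasFDerivAt f (fderiv ℝ f x) (x + (0 : ℝ) • h) := by simpa using h1
        exact h1.comp_hasDerivAt 0 h3
      rw [hasDerivAt_iff_tendsto_slope_zero] at h2
      simpa [HasDirDeriv] using h2
    · refine ih (hU.prod isOpen_univ) ?_
      have h1 : ContDiffOn ℝ n (fderiv ℝ f) U := hf.fderiv_of_isOpen hU (by simp)
      exact ContDiffOn.clm_apply (h1.comp contDiff_fst.contDiffOn fun p hp => hp.1)
        contDiff_snd.contDiffOn

/-! ### Smoothness at a point -/

section Near

variable {E : Type*} [AddCommGroup E] [Module ℝ E] [TopologicalSpace E]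
  [IsTopologicalAddGroup E] [ContinuousSMul ℝ E]
variable {F : Type*} [AddCommGroup F] [Module ℝ F] [TopologicalSpace F]
  [IsTopologicalAddGroup F] [ContinuousSMul ℝ F] [LocallyConvexSpace ℝ F] [T2Space F]
variable {Z : Type*} [AddCommGroup Z] [Module ℝ Z] [TopologicalSpace Z]
  [IsTopologicalAddGroup Z] [ContinuousSMul ℝ Z] [LocallyConvexSpace ℝ Z] [T2Space Z]

/-- `f` is smooth on a neighbourhood of `x`. -/
def SmoothNear {E F : Type*} [AddCommGroup E] [Module ℝ E] [TopologicalSpace E]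
    [AddCommGroup F] [Module ℝ F] [TopologicalSpace F] (f : E → F) (x : E) : Prop :=
  ∃ U, IsOpen U ∧ x ∈ U ∧ ∀ n, CB n f U

/-- Each `CB n` is a local property. Smoothness thereby becomes a pointwise notion, stable under
composition without tracking domains. -/
theorem smoothOnOpen_iff {f : E → F} {U : Set E} (hU : IsOpen U) :
    SmoothOnOpen f U ↔ ∀ x ∈ U, SmoothNear f x := by
  refine ⟨fun h x hx => ⟨U, hU, hx, h.cb hU⟩, fun h => CB.smoothOnOpen hU fun n =>
    CB.of_locally fun x hx => ?_⟩
  obtain ⟨V, hV, hxV, hf⟩ := h x hx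
  exact ⟨V, hV, hxV, hf n⟩

theorem SmoothNear.continuousAt {f : E → F} {x : E} (hf : SmoothNear f x) : ContinuousAt f x := by
  obtain ⟨U, hU, hx, h⟩ := hf
  exact ContinuousOn.continuousAt (h 0) (hU.mem_nhds hx)

theorem SmoothNear.congr {f g : E → F} {x : E} (hf : SmoothNear f x) (hfg : f =ᶠ[𝓝 x] g) :
    SmoothNear g x := by
  obtain ⟨U, hU, hx, h⟩ := hf
  obtain ⟨V, hVfg, hV, hxV⟩ := mem_nhds_iff.1 hfg
  exact ⟨U ∩ V, hU.inter hV, ⟨hx, hxV⟩, fun n => ((h n).mono inter_subset_left).congr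
    (hU.inter hV) fun y hy => hVfg hy.2⟩

theorem SmoothNear.comp {f : E → F} {g : F → Z} {x : E} (hg : SmoothNear g (f x))
    (hf : SmoothNear f x) : SmoothNear (fun y => g (f y)) x := by
  obtain ⟨U, hU, hx, hf⟩ := hf
  obtain ⟨V, hV, hxV, hg⟩ := hg
  have hO : IsOpen (U ∩ f ⁻¹' V) := ContinuousOn.isOpen_inter_preimage (hf 0) hU hV
  exact ⟨U ∩ f ⁻¹' V, hO, ⟨hx, hxV⟩, fun n => CB.comp hO hV (hg n) ((hf n).mono inter_subset_left)
    fun y hy => hy.2⟩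

theorem SmoothNear.prodMk {f : E → F} {g : E → Z} {x : E} (hf : SmoothNear f x)
    (hg : SmoothNear g x) : SmoothNear (fun y => (f y, g y)) x := by
  obtain ⟨U, hU, hx, hf⟩ := hf
  obtain ⟨V, hV, hxV, hg⟩ := hg
  exact ⟨U ∩ V, hU.inter hV, ⟨hx, hxV⟩, fun n => CB.prodMk (hU.inter hV)
    ((hf n).mono inter_subset_left) ((hg n).mono inter_subset_right)⟩

theorem SmoothNear.const (c : F) (x : E) : SmoothNear (fun _ => c) x :=
  ⟨univ, isOpen_univ, mem_univ _, fun _ => CB.const c isOpen_univ⟩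

theorem ContinuousLinearMap.smoothNear (L : E →L[ℝ] F) (x : E) : SmoothNear (fun y => L y) x :=
  ⟨univ, isOpen_univ, mem_univ _, fun _ => CB.clm isOpen_univ L⟩

end Near

open scoped ContDiff in
theorem ContDiffOn.smoothNear {E F : Type*} [NormedAddCommGroup E] [NormedSpace ℝ E]
    [NormedAddCommGroup F] [NormedSpace ℝ F] {f : E → F} {U : Set E} (hf : ContDiffOn ℝ ∞ f U)
    (hU : IsOpen U) {x : E} (hx : x ∈ U) : SmoothNear f x :=
  ⟨U, hU, hx, fun _ => ContDiffOn.cb hU (hf.of_le (by exact_mod_cast le_top))⟩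

open scoped ContDiff in
theorem ContDiff.smoothNear {E F : Type*} [NormedAddCommGroup E] [NormedSpace ℝ E]
    [NormedAddCommGroup F] [NormedSpace ℝ F] {f : E → F} (hf : ContDiff ℝ ∞ f) (x : E) :
    SmoothNear f x :=
  hf.contDiffOn.smoothNear isOpen_univ (mem_univ x)

/-! ### Manifolds -/

section ManifoldCalculus

/-- The coordinate changes of `M` are smooth. -/
class SmoothMfd (E M : Type*) [AddCommGroup E] [Module ℝ E] [TopologicalSpace E]
    [TopologicalSpace M] [ChartedSpace E M] : Prop where
  compatible : ∀ e ∈ atlas E M, ∀ e' ∈ atlas E M,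
    SmoothOnOpen (fun x => e' (e.symm x)) (e.target ∩ e.symm ⁻¹' e'.source)

/-- `f` is continuous at `x` and smooth near `x` in all charts. -/
def MSmoothAt (E F : Type*) [AddCommGroup E] [Module ℝ E] [TopologicalSpace E]
    [AddCommGroup F] [Module ℝ F] [TopologicalSpace F] {M N : Type*} [TopologicalSpace M]
    [ChartedSpace E M] [TopologicalSpace N] [ChartedSpace F N] (f : M → N) (x : M) : Prop :=
  ContinuousAt f x ∧ ∀ e ∈ atlas E M, x ∈ e.source → ∀ e' ∈ atlas F N, f x ∈ e'.source →
    SmoothNear (fun y => e' (f (e.symm y))) (e x)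

variable {E : Type*} [AddCommGroup E] [Module ℝ E] [TopologicalSpace E]
  [IsTopologicalAddGroup E] [ContinuousSMul ℝ E] [LocallyConvexSpace ℝ E] [T2Space E]
variable {F : Type*} [AddCommGroup F] [Module ℝ F] [TopologicalSpace F]
  [IsTopologicalAddGroup F] [ContinuousSMul ℝ F] [LocallyConvexSpace ℝ F] [T2Space F]
variable {Z : Type*} [AddCommGroup Z] [Module ℝ Z] [TopologicalSpace Z]
  [IsTopologicalAddGroup Z] [ContinuousSMul ℝ Z] [LocallyConvexSpace ℝ Z] [T2Space Z]
variable {Z' : Type*} [AddCommGroup Z'] [Module ℝ Z'] [TopologicalSpace Z']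
  [IsTopologicalAddGroup Z'] [ContinuousSMul ℝ Z'] [LocallyConvexSpace ℝ Z'] [T2Space Z']
variable {M N P : Type*} [TopologicalSpace M] [ChartedSpace E M]
  [TopologicalSpace N] [ChartedSpace F N] [TopologicalSpace P] [ChartedSpace Z P]

theorem smoothMapOn_iff {f : M → N} {s : Set M} (hs : IsOpen s) :
    SmoothMapOn E F f s ↔ ∀ x ∈ s, MSmoothAt E F f x := by
  constructor
  · rintro ⟨hc, h⟩ x hx
    refine ⟨hc.continuousAt (hs.mem_nhds hx), fun e he hxe e' he' hxe' => ?_⟩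
    refine (smoothOnOpen_iff (e.isOpen_inter_preimage_symm
      (hc.isOpen_inter_preimage hs e'.open_source))).1 (h e he e' he') _ ⟨e.map_source hxe, ?_⟩
    simpa [hxe] using ⟨hx, hxe'⟩
  · intro h
    have hc : ContinuousOn f s := fun x hx => (h x hx).1.continuousWithinAt
    refine ⟨hc, fun e he e' he' => (smoothOnOpen_iff (e.isOpen_inter_preimage_symm
      (hc.isOpen_inter_preimage hs e'.open_source))).2 fun y hy => ?_⟩
    have := (h _ hy.2.1).2 e he (e.map_target hy.1) e' he' hy.2.2
    rwa [e.right_inv hy.1] at this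

theorem SmoothMapOn.mSmoothAt {f : M → N} {s : Set M} (h : SmoothMapOn E F f s) (hs : IsOpen s)
    {x : M} (hx : x ∈ s) : MSmoothAt E F f x :=
  (smoothMapOn_iff hs).1 h x hx

theorem smoothMapOn_univ_iff {f : M → N} :
    SmoothMapOn E F f univ ↔ ∀ x, MSmoothAt E F f x := by
  simp [smoothMapOn_iff isOpen_univ]

/-- Points of `M` near `x`, in a chart around `x`. -/
theorem eventually_chart {e : OpenPartialHomeomorph M E} {x : M} (hx : x ∈ e.source)
    {p : M → Prop} (hp : ∀ᶠ y in 𝓝 x, p y) : ∀ᶠ y in 𝓝 (e x), p (e.symm y) := by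
  have := (e.continuousAt_symm (e.map_source hx)).eventually (p := p)
  rw [e.left_inv hx] at this
  exact this hp

theorem MSmoothAt.congr {f g : M → N} {x : M} (hf : MSmoothAt E F f x) (hfg : f =ᶠ[𝓝 x] g) :
    MSmoothAt E F g x := by
  refine ⟨hf.1.congr hfg, fun e he hx e' he' hx' => ?_⟩
  refine (hf.2 e he hx e' he' (by rwa [hfg.self_of_nhds])).congr ?_
  filter_upwards [eventually_chart hx hfg] with y hy
  rw [hy]

theorem MSmoothAt.comp {g : N → P} {f : M → N} {x : M} (hg : MSmoothAt F Z g (f x))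
    (hf : MSmoothAt E F f x) : MSmoothAt E Z (fun y => g (f y)) x := by
  refine ⟨hg.1.comp hf.1, fun e he hx e' he' hx' => ?_⟩
  have h1 := hf.2 e he hx _ (chart_mem_atlas F (f x)) (mem_chart_source F (f x))
  have h2 := hg.2 _ (chart_mem_atlas F (f x)) (mem_chart_source F (f x)) e' he' hx'
  have h3 : SmoothNear (fun y => e' (g ((chartAt F (f x)).symm y)))
      (chartAt F (f x) (f (e.symm (e x)))) := by rwa [e.left_inv hx]
  refine (SmoothNear.comp (g := fun y => e' (g ((chartAt F (f x)).symm y)))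
    (f := fun y => chartAt F (f x) (f (e.symm y))) h3 h1).congr ?_
  filter_upwards [eventually_chart hx (hf.1.eventually
    ((chartAt F (f x)).open_source.mem_nhds (mem_chart_source F (f x))))] with y hy
  rw [(chartAt F (f x)).left_inv hy]

theorem MSmoothAt.const (c : N) (x : M) : MSmoothAt E F (fun _ : M => c) x :=
  ⟨continuousAt_const, fun _ _ _ _ _ _ => SmoothNear.const _ _⟩

theorem MSmoothAt.id [SmoothMfd E M] (x : M) : MSmoothAt E E (fun y : M => y) x :=
  ⟨continuousAt_id, fun e he hx e' he' hx' => (smoothOnOpen_iff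
    (e.isOpen_inter_preimage_symm e'.open_source)).1 (SmoothMfd.compatible e he e' he') _
      ⟨e.map_source hx, by simpa [hx] using hx'⟩⟩

theorem mem_atlas_prod {e : OpenPartialHomeomorph (M × N) (E × F)} :
    e ∈ atlas (E × F) (M × N) ↔ ∃ e₁ ∈ atlas E M, ∃ e₂ ∈ atlas F N, e₁.prod e₂ = e :=
  Iff.rfl

theorem MSmoothAt.fst [SmoothMfd E M] (x : M × N) :
    MSmoothAt (E × F) E (fun y : M × N => y.1) x := by
  refine ⟨continuousAt_fst, fun e he hx e' he' hx' => ?_⟩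
  obtain ⟨e₁, he₁, e₂, he₂, rfl⟩ := mem_atlas_prod.1 he
  exact SmoothNear.comp (g := fun y => e' (e₁.symm y)) (f := fun y : E × F => y.1)
    ((MSmoothAt.id x.1).2 e₁ he₁ hx.1 e' he' hx')
    ((ContinuousLinearMap.fst ℝ E F).smoothNear _)

theorem MSmoothAt.snd [SmoothMfd F N] (x : M × N) :
    MSmoothAt (E × F) F (fun y : M × N => y.2) x := by
  refine ⟨continuousAt_snd, fun e he hx e' he' hx' => ?_⟩
  obtain ⟨e₁, he₁, e₂, he₂, rfl⟩ := mem_atlas_prod.1 he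
  exact SmoothNear.comp (g := fun y => e' (e₂.symm y)) (f := fun y : E × F => y.2)
    ((MSmoothAt.id x.2).2 e₂ he₂ hx.2 e' he' hx')
    ((ContinuousLinearMap.snd ℝ E F).smoothNear _)

theorem MSmoothAt.prodMk {f : M → N} {g : M → P} {x : M} (hf : MSmoothAt E F f x)
    (hg : MSmoothAt E Z g x) : MSmoothAt E (F × Z) (fun y => (f y, g y)) x := by
  refine ⟨hf.1.prodMk hg.1, fun e he hx e' he' hx' => ?_⟩
  obtain ⟨e₁, he₁, e₂, he₂, rfl⟩ := mem_atlas_prod.1 he'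
  exact (hf.2 e he hx e₁ he₁ hx'.1).prodMk (hg.2 e he hx e₂ he₂ hx'.2)

instance [SmoothMfd E M] [SmoothMfd F N] : SmoothMfd (E × F) (M × N) where
  compatible e he e' he' := by
    -- Compatibility of an atlas is smoothness of the identity, here read off from the two
    -- projections.
    have h : ∀ x : M × N, MSmoothAt (E × F) (E × F) (fun y : M × N => y) x := fun x =>
      (MSmoothAt.fst x).prodMk (MSmoothAt.snd x)
    have := (smoothMapOn_univ_iff.2 h).2 e he e' he'
    simpa using this

/-! Maps into and between vector spaces. -/

theorem mSmoothAt_vec_iff {f : M → F} {x : M} :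
    MSmoothAt E F f x ↔ ContinuousAt f x ∧ ∀ e ∈ atlas E M, x ∈ e.source →
      SmoothNear (fun y => f (e.symm y)) (e x) := by
  simp [MSmoothAt]

theorem mSmoothAt_model_iff {f : E → F} {x : E} : MSmoothAt E F f x ↔ SmoothNear f x := by
  simp only [mSmoothAt_vec_iff, chartedSpaceSelf_atlas, forall_eq]
  exact ⟨fun h => h.2 (mem_univ _), fun h => ⟨h.continuousAt, fun _ => h⟩⟩

theorem SmoothNear.compM {Φ : F → Z} {f : M → F} {x : M} (hΦ : SmoothNear Φ (f x))
    (hf : MSmoothAt E F f x) : MSmoothAt E Z (fun y => Φ (f y)) x :=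
  MSmoothAt.comp (mSmoothAt_model_iff.2 hΦ) hf

theorem SmoothNear.compM₂ {Φ : F × Z → Z'} {f : M → F} {g : M → Z} {x : M}
    (hΦ : SmoothNear Φ (f x, g x)) (hf : MSmoothAt E F f x) (hg : MSmoothAt E Z g x) :
    MSmoothAt E Z' (fun y => Φ (f y, g y)) x := by
  rw [mSmoothAt_vec_iff] at *
  refine ⟨hΦ.continuousAt.comp (f := fun y => (f y, g y)) (hf.1.prodMk hg.1), fun e he hx => ?_⟩
  refine SmoothNear.comp (f := fun y => (f (e.symm y), g (e.symm y))) ?_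
    ((hf.2 e he hx).prodMk (hg.2 e he hx))
  rwa [e.left_inv hx]

instance : SmoothMfd E E where
  compatible := by
    simp only [chartedSpaceSelf_atlas, forall_eq]
    exact (smoothOnOpen_iff (by simp)).2 fun x _ => (ContinuousLinearMap.id ℝ E).smoothNear x

instance {G : Type*} [Group G] [TopologicalSpace G] [ChartedSpace E G]
    [h : IsLocConvexLieGroup E G] : SmoothMfd E G :=
  ⟨h.compatible⟩

end ManifoldCalculus

/-! ### The circle group -/

section CircleGroup

open Metric Module
open scoped ContDiff

theorem finrank_complex_fact : Fact (finrank ℝ ℂ = 1 + 1) := Complex.finrank_real_complex_fact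

attribute [local instance] finrank_complex_fact

theorem isInducing_circle_coe : Topology.IsInducing fun z : Circle => (z : ℂ) := ⟨rfl⟩

theorem circle_atlas {e : OpenPartialHomeomorph Circle CircleModel} :
    e ∈ atlas CircleModel Circle ↔ ∃ v : sphere (0 : ℂ) 1, e = stereographic' 1 v := Iff.rfl

theorem contDiff_circle_chart_symm {e : OpenPartialHomeomorph Circle CircleModel}
    (he : e ∈ atlas CircleModel Circle) : ContDiff ℝ ∞ fun x => ((e.symm x : Circle) : ℂ) := by
  obtain ⟨v, rfl⟩ := circle_atlas.1 he
  let U := (OrthonormalBasis.fromOrthogonalSpanSingleton (𝕜 := ℝ) 1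
    (ne_zero_of_mem_unit_sphere v)).repr
  exact (contDiff_stereoInvFunAux.comp (ℝ ∙ (v : ℂ))ᗮ.subtypeL.contDiff).comp U.symm.contDiff

/-- The stereographic formula with pole v makes sense on the open set of z ∈ ℂ with ⟨v,z⟩ ≠ 1, so a
chart of the circle is the restriction of a smooth map on an open subset of ℂ. -/
theorem circle_chart_extend {e : OpenPartialHomeomorph Circle CircleModel}
    (he : e ∈ atlas CircleModel Circle) : ∃ (Φ : ℂ → CircleModel) (V : Set ℂ), IsOpen V ∧
      ContDiffOn ℝ ∞ Φ V ∧ (∀ z ∈ e.source, (z : ℂ) ∈ V) ∧ ∀ z : Circle, e z = Φ z := by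
  obtain ⟨v, rfl⟩ := circle_atlas.1 he
  let U := (OrthonormalBasis.fromOrthogonalSpanSingleton (𝕜 := ℝ) 1
    (ne_zero_of_mem_unit_sphere v)).repr
  refine ⟨fun z => U (stereoToFun (v : ℂ) z), {z | innerSL ℝ (v : ℂ) z ≠ (1 : ℝ)},
    isOpen_ne_fun (innerSL ℝ (v : ℂ)).continuous continuous_const,
    U.contDiff.comp_contDiffOn contDiffOn_stereoToFun, fun z hz => ?_, fun z => rfl⟩
  have h1 : (z : sphere (0 : ℂ) 1) ≠ v := by
    have := (stereographic'_source (n := 1) v) ▸ hz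
    exact this
  intro h
  exact h1 ((sphere_ext_iff _ _).2 (by rw [real_inner_comm]; exact h))

variable {E : Type*} [AddCommGroup E] [Module ℝ E] [TopologicalSpace E]
  [IsTopologicalAddGroup E] [ContinuousSMul ℝ E] [LocallyConvexSpace ℝ E] [T2Space E]
variable {M : Type*} [TopologicalSpace M] [ChartedSpace E M]

theorem mSmoothAt_circle_coe (z : Circle) : MSmoothAt CircleModel ℂ (fun w : Circle => (w : ℂ)) z :=
  mSmoothAt_vec_iff.2 ⟨isInducing_circle_coe.continuous.continuousAt, fun _ he _ =>
    (contDiff_circle_chart_symm he).smoothNear _⟩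

theorem MSmoothAt.circle_coe {f : M → Circle} {x : M} (hf : MSmoothAt E CircleModel f x) :
    MSmoothAt E ℂ (fun y => (f y : ℂ)) x :=
  (mSmoothAt_circle_coe (f x)).comp hf

/-- The circle is embedded in ℂ and its charts extend smoothly to open subsets of ℂ, so smoothness
into it can be tested in ℂ. -/
theorem MSmoothAt.of_circle_coe {f : M → Circle} {x : M}
    (hf : MSmoothAt E ℂ (fun y => (f y : ℂ)) x) : MSmoothAt E CircleModel f x := by
  refine ⟨isInducing_circle_coe.continuousAt_iff.2 hf.1, fun e he hx e' he' hx' => ?_⟩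
  obtain ⟨Φ, V, hV, hΦ, hsV, h⟩ := circle_chart_extend he'
  simp only [h]
  refine SmoothNear.comp (g := Φ) (hΦ.smoothNear hV ?_) ((mSmoothAt_vec_iff.1 hf).2 e he hx)
  rw [e.left_inv hx]
  exact hsV _ hx'

instance : SmoothMfd CircleModel Circle where
  compatible e he e' he' := by
    have h : ∀ x : Circle, MSmoothAt CircleModel CircleModel (fun y : Circle => y) x := fun x =>
      MSmoothAt.of_circle_coe (mSmoothAt_circle_coe x)
    have := (smoothMapOn_univ_iff.2 h).2 e he e' he'
    simpa using this

end CircleGroup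

/-! ### The projective space -/

section Projective

variable {H : Type*} [NormedAddCommGroup H] [InnerProductSpace ℂ H]

theorem mk_mem_affineDomain {φ v : H} (hv : v ≠ 0) :
    Projectivization.mk ℂ v hv ∈ affineDomain φ ↔ inner ℂ φ v ≠ 0 := by
  obtain ⟨a, ha⟩ := Projectivization.exists_smul_eq_mk_rep ℂ v hv
  have ha0 : (a : ℂ) ≠ 0 := a.ne_zero
  change inner ℂ φ (Projectivization.mk ℂ v hv).rep ≠ 0 ↔ _
  rw [← ha, Units.smul_def, inner_smul_right]
  simp

theorem affineChart_mk_eq {φ v : H} (hv : v ≠ 0) :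
    affineChart φ (Projectivization.mk ℂ v hv) =
      (ℂ ∙ φ)ᗮ.orthogonalProjectionOnto (((‖φ‖ : ℂ) ^ 2 / inner ℂ φ v) • v) := by
  obtain ⟨a, ha⟩ := Projectivization.exists_smul_eq_mk_rep ℂ v hv
  have ha0 : (a : ℂ) ≠ 0 := a.ne_zero
  rw [affineChart, ← ha, Units.smul_def, inner_smul_right, smul_smul]
  congr 2
  rcases eq_or_ne (inner ℂ φ v) 0 with h | h
  · simp [h]
  · field_simp

/-- A vector is determined by its ray and its scalar product with `φ`. -/
theorem eq_smul_add_affineChart {φ v : H} (hv : v ≠ 0) (h : inner ℂ φ v ≠ 0) :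
    v = (inner ℂ φ v / (‖φ‖ : ℂ) ^ 2) •
      (φ + (affineChart φ (Projectivization.mk ℂ v hv) : (ℂ ∙ φ)ᗮ)) := by
  have hφ : φ ≠ 0 := by rintro rfl; simp at h
  have hn : (‖φ‖ : ℂ) ≠ 0 := by simpa using hφ
  set w := ((‖φ‖ : ℂ) ^ 2 / inner ℂ φ v) • v with hw
  -- The rescaling is chosen so that ⟨φ,w⟩ = ‖φ‖²; the component of w along φ is therefore φ itself.
  have hin : inner ℂ φ (w - φ) = 0 := by
    rw [inner_sub_right, hw, inner_smul_right, inner_self_eq_norm_sq_to_K]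
    field_simp
    simp
  have hmem : w - φ ∈ (ℂ ∙ φ)ᗮ := Submodule.mem_orthogonal_singleton_iff_inner_right.2 hin
  have hP : (ℂ ∙ φ)ᗮ.orthogonalProjectionOnto w = ⟨w - φ, hmem⟩ := by
    have e : w = φ + ((⟨w - φ, hmem⟩ : (ℂ ∙ φ)ᗮ) : H) := by simp
    conv_lhs => rw [e]
    rw [map_add, Submodule.orthogonalProjectionOnto_orthogonalComplement_singleton_eq_zero,
      zero_add, Submodule.orthogonalProjectionOnto_mem_subspace_eq_self]
  rw [affineChart_mk_eq, hP]
  simp only [add_sub_cancel, hw, smul_smul]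
  rw [div_mul_div_cancel₀ (by positivity), div_self h, one_smul]

theorem continuous_projMk :
    Continuous fun v : {v : H // v ≠ 0} => Projectivization.mk ℂ v.1 v.2 :=
  continuous_coinduced_rng

theorem isQuotientMap_projMk :
    Topology.IsQuotientMap fun v : {v : H // v ≠ 0} => Projectivization.mk ℂ v.1 v.2 :=
  ⟨⟨rfl⟩, fun p => ⟨⟨p.rep, p.rep_nonzero⟩, p.mk_rep⟩⟩

/-- The saturation of an open set is the union of its nonzero multiples. Openness later turns
density of rays into density of vectors. -/
theorem isOpenMap_projMk :
    IsOpenMap fun v : {v : H // v ≠ 0} => Projectivization.mk ℂ v.1 v.2 := by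
  intro O hO
  rw [← isQuotientMap_projMk.isOpen_preimage]
  have : (fun v : {v : H // v ≠ 0} => Projectivization.mk ℂ v.1 v.2) ⁻¹'
      ((fun v : {v : H // v ≠ 0} => Projectivization.mk ℂ v.1 v.2) '' O) =
      ⋃ a : ℂˣ, (fun v : {v : H // v ≠ 0} =>
        (⟨(a : ℂ) • v.1, smul_ne_zero a.ne_zero v.2⟩ : {v : H // v ≠ 0})) ⁻¹' O := by
    ext v
    simp only [mem_preimage, mem_image, mem_iUnion]
    constructor
    · rintro ⟨w, hw, hwv⟩
      obtain ⟨a, ha⟩ := (Projectivization.mk_eq_mk_iff ℂ _ _ w.2 v.2).1 hwv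
      exact ⟨a, by simpa [← Units.smul_def, ha] using hw⟩
    · rintro ⟨a, ha⟩
      exact ⟨_, ha, (Projectivization.mk_eq_mk_iff ℂ _ _ _ v.2).2 ⟨a, rfl⟩⟩
  rw [this]
  exact isOpen_iUnion fun a => hO.preimage (by fun_prop)

theorem isOpen_affineDomain (φ : H) : IsOpen (affineDomain φ) := by
  rw [← isQuotientMap_projMk.isOpen_preimage]
  have : (fun v : {v : H // v ≠ 0} => Projectivization.mk ℂ v.1 v.2) ⁻¹' affineDomain φ =
      {v | inner ℂ φ v.1 ≠ 0} := by
    ext v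
    exact mk_mem_affineDomain v.2
  rw [this]
  exact isOpen_ne_fun (by fun_prop) continuous_const

theorem continuousOn_affineChart (φ : H) : ContinuousOn (affineChart φ) (affineDomain φ) := by
  have : ContinuousOn (fun v : {v : H // v ≠ 0} =>
      (ℂ ∙ φ)ᗮ.orthogonalProjectionOnto (((‖φ‖ : ℂ) ^ 2 / inner ℂ φ v.1) • v.1))
      {v | inner ℂ φ v.1 ≠ 0} := by
    refine ((ℂ ∙ φ)ᗮ.orthogonalProjectionOnto).continuous.comp_continuousOn ?_
    refine ContinuousOn.smul (continuousOn_const.div (by fun_prop) fun v hv => hv) (by fun_prop)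
  refine (isQuotientMap_projMk.continuousOn_isOpen_iff (g := affineChart φ)
    (isOpen_affineDomain φ)).2 ((this.congr fun v _ => affineChart_mk_eq v.2).mono fun v hv => ?_)
  exact (mk_mem_affineDomain v.2).1 hv

/-- Continuity of a map into `H` can be tested on rays and by a single scalar product. -/
theorem continuousAt_of_ray {X : Type*} [TopologicalSpace X] {f : X → H} (hf : ∀ x, f x ≠ 0)
    {φ : H} {x : X} (hφ : inner ℂ φ (f x) ≠ 0)
    (hray : ContinuousAt (fun x => Projectivization.mk ℂ (f x) (hf x)) x)
    (hin : ContinuousAt (fun x => inner ℂ φ (f x)) x) : ContinuousAt f x := by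
  have h1 : ContinuousAt (fun y => affineChart φ (Projectivization.mk ℂ (f y) (hf y))) x :=
    ((continuousOn_affineChart φ).continuousAt ((isOpen_affineDomain φ).mem_nhds
      ((mk_mem_affineDomain (hf x)).2 hφ))).comp (f := fun y => Projectivization.mk ℂ (f y) (hf y))
        hray
  have h2 : ContinuousAt (fun y => (inner ℂ φ (f y) / (‖φ‖ : ℂ) ^ 2) •
      (φ + (affineChart φ (Projectivization.mk ℂ (f y) (hf y)) : H))) x :=
    (hin.div_const ((‖φ‖ : ℂ) ^ 2)).smul (continuousAt_const.add
      (continuous_subtype_val.continuousAt.comp h1))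
  refine h2.congr ?_
  filter_upwards [hin.eventually_ne hφ] with y hy
  exact (eq_smul_add_affineChart (hf y) hy).symm

variable {E : Type*} [AddCommGroup E] [Module ℝ E] [TopologicalSpace E]
  [IsTopologicalAddGroup E] [ContinuousSMul ℝ E] [LocallyConvexSpace ℝ E] [T2Space E]
variable {E' : Type*} [AddCommGroup E'] [Module ℝ E'] [TopologicalSpace E']
  [IsTopologicalAddGroup E'] [ContinuousSMul ℝ E'] [LocallyConvexSpace ℝ E'] [T2Space E']
variable {M : Type*} [TopologicalSpace M] [ChartedSpace E M]
variable {N : Type*} [TopologicalSpace N] [ChartedSpace E' N]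

/-- Smoothness at a point of maps into the projective space. -/
def PSmoothAt (E : Type*) [AddCommGroup E] [Module ℝ E] [TopologicalSpace E]
    {M : Type*} [TopologicalSpace M] [ChartedSpace E M] (f : M → ℙ ℂ H) (x : M) : Prop :=
  ContinuousAt f x ∧ ∀ φ : H, φ ≠ 0 → f x ∈ affineDomain φ →
    MSmoothAt E (ℂ ∙ φ)ᗮ (fun m => affineChart φ (f m)) x

theorem smoothToProj_iff {f : M → ℙ ℂ H} : SmoothToProj E f ↔ ∀ x, PSmoothAt E f x := by
  constructor
  · intro h x
    exact ⟨h.1.continuousAt, fun φ hφ hx => (h.2 φ hφ).mSmoothAt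
      ((isOpen_affineDomain φ).preimage h.1) hx⟩
  · intro h
    have hc : Continuous f := continuous_iff_continuousAt.2 fun x => (h x).1
    exact ⟨hc, fun φ hφ => (smoothMapOn_iff ((isOpen_affineDomain φ).preimage hc)).2
      fun x hx => (h x).2 φ hφ hx⟩

theorem PSmoothAt.comp {f : N → ℙ ℂ H} {h : M → N} {x : M} (hf : PSmoothAt E' f (h x))
    (hh : MSmoothAt E E' h x) : PSmoothAt E (fun m => f (h m)) x :=
  ⟨hf.1.comp hh.1, fun φ hφ hx => (hf.2 φ hφ hx).comp hh⟩

open scoped ContDiff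

theorem contDiff_inner_left (φ : H) : ContDiff ℝ ∞ fun v : H => inner ℂ φ v :=
  (innerSL ℂ φ).contDiff.restrict_scalars ℝ

theorem MSmoothAt.inner_const {f : M → H} {x : M} (hf : MSmoothAt E H f x) (φ : H) :
    MSmoothAt E ℂ (fun m => inner ℂ φ (f m)) x :=
  ((contDiff_inner_left φ).smoothNear _).compM hf

/-- Smoothness of a map into `H` can be tested on rays and by a single scalar product. -/
theorem MSmoothAt.of_ray {f : M → H} (hf : ∀ x, f x ≠ 0) {φ : H} {x : M}
    (hφ : inner ℂ φ (f x) ≠ 0)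
    (hray : PSmoothAt E (fun x => Projectivization.mk ℂ (f x) (hf x)) x)
    (hin : MSmoothAt E ℂ (fun x => inner ℂ φ (f x)) x) : MSmoothAt E H f x := by
  have hφ0 : φ ≠ 0 := by rintro rfl; simp at hφ
  have h1 := hray.2 φ hφ0 ((mk_mem_affineDomain (hf x)).2 hφ)
  have h2 : ContDiff ℝ ∞ fun p : ℂ × (ℂ ∙ φ)ᗮ => (p.1 / (‖φ‖ : ℂ) ^ 2) • (φ + (p.2 : H)) := by
    refine (contDiff_fst.div_const _).smul (contDiff_const.add ?_)
    exact ((ℂ ∙ φ)ᗮ.subtypeL.contDiff.restrict_scalars ℝ).comp contDiff_snd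
  refine ((h2.smoothNear _).compM₂ hin h1).congr ?_
  filter_upwards [hin.1.eventually_ne hφ] with y hy
  exact (eq_smul_add_affineChart (hf y) hy).symm

theorem MSmoothAt.projMk {f : M → H} (hf : ∀ x, f x ≠ 0) {x : M} (h : MSmoothAt E H f x) :
    PSmoothAt E (fun x => Projectivization.mk ℂ (f x) (hf x)) x := by
  refine ⟨?_, fun φ hφ hx => ?_⟩
  · exact continuous_projMk.continuousAt.comp (f := fun x => (⟨f x, hf x⟩ : {v : H // v ≠ 0}))
      (Topology.IsInducing.subtypeVal.continuousAt_iff.2 h.1)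
  · simp only [affineChart_mk_eq]
    rw [mk_mem_affineDomain] at hx
    refine SmoothNear.compM (Φ := fun v : H => (ℂ ∙ φ)ᗮ.orthogonalProjectionOnto
      (((‖φ‖ : ℂ) ^ 2 / inner ℂ φ v) • v)) ?_ h
    have : ContDiffOn ℝ ∞ (fun v : H => (ℂ ∙ φ)ᗮ.orthogonalProjectionOnto
        (((‖φ‖ : ℂ) ^ 2 / inner ℂ φ v) • v)) {v | inner ℂ φ v ≠ 0} := by
      refine ((ℂ ∙ φ)ᗮ.orthogonalProjectionOnto.contDiff.restrict_scalars ℝ).comp_contDiffOn ?_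
      have hdiv : ContDiffOn ℝ ∞ (fun v : H => (‖φ‖ : ℂ) ^ 2 / inner ℂ φ v)
          {v | inner ℂ φ v ≠ 0} := by
        simp only [div_eq_mul_inv]
        exact contDiffOn_const.mul ((contDiff_inner_left φ).contDiffOn.fun_inv fun v hv => hv)
      exact hdiv.smul contDiffOn_id
    exact this.smoothNear (isOpen_ne_fun (by fun_prop) continuous_const) hx

end Projective

/-! ### The phase of a complex number -/

section Phase

/-- The phase `w / |w|` of a complex number `w ≠ 0`. -/
noncomputable def phase (w : ℂ) : Circle := Circle.exp w.arg

theorem coe_phase {w : ℂ} (hw : w ≠ 0) : (phase w : ℂ) = w / ‖w‖ := by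
  have hn : (‖w‖ : ℂ) ≠ 0 := by simpa using hw
  rw [eq_div_iff hn, mul_comm, phase, Circle.coe_exp, Complex.norm_mul_exp_arg_mul_I]

theorem phase_mul_ofReal (z : Circle) {r : ℝ} (hr : 0 < r) : phase (z * r) = z := by
  have hr' : (r : ℂ) ≠ 0 := by exact_mod_cast hr.ne'
  ext
  rw [coe_phase (mul_ne_zero z.coe_ne_zero hr')]
  rw [norm_mul, Circle.norm_coe, one_mul, Complex.norm_real, Real.norm_of_nonneg hr.le,
    mul_div_cancel_right₀ _ hr']

variable {E : Type*} [AddCommGroup E] [Module ℝ E] [TopologicalSpace E]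
  [IsTopologicalAddGroup E] [ContinuousSMul ℝ E] [LocallyConvexSpace ℝ E] [T2Space E]
variable {M : Type*} [TopologicalSpace M] [ChartedSpace E M]

theorem continuousAt_phase {w : ℂ} (hw : w ≠ 0) : ContinuousAt phase w := by
  rw [isInducing_circle_coe.continuousAt_iff]
  have : ContinuousAt (fun w : ℂ => w / ‖w‖) w :=
    continuousAt_id.div (by fun_prop) (by simpa using hw)
  refine this.congr ?_
  filter_upwards [eventually_ne_nhds hw] with v hv
  exact (coe_phase hv).symm

open scoped ContDiff in
theorem MSmoothAt.phase {f : M → ℂ} {x : M} (hf : MSmoothAt E ℂ f x) (hx : f x ≠ 0) :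
    MSmoothAt E CircleModel (fun y => phase (f y)) x := by
  have h : ContDiffOn ℝ ∞ (fun w : ℂ => w / (‖w‖ : ℂ)) {w | w ≠ 0} := by
    have hn : ContDiffOn ℝ ∞ (fun w : ℂ => (‖w‖ : ℂ)) {w | w ≠ 0} :=
      Complex.ofRealCLM.contDiff.comp_contDiffOn fun w hw =>
        (contDiffAt_norm ℝ hw).contDiffWithinAt
    simp only [div_eq_mul_inv]
    exact contDiffOn_id.mul (hn.fun_inv fun w hw => by simpa using hw)
  refine MSmoothAt.of_circle_coe (((h.smoothNear isOpen_ne hx).compM hf).congr ?_)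
  filter_upwards [hf.1.eventually_ne hx] with y hy
  exact (coe_phase hy).symm

end Phase

/-! ### Algebra of the central extension -/

section Sharp

variable {H : Type*} [NormedAddCommGroup H] [InnerProductSpace ℂ H] [CompleteSpace H]

theorem unitary_inner_smul_smul (U : UnitaryGp H) (v w : H) :
    inner ℂ (U • v) (U • w) = inner ℂ v w :=
  ContinuousLinearMap.inner_map_map_of_mem_unitary U.2 v w

theorem unitary_norm_smul (U : UnitaryGp H) (v : H) : ‖U • v‖ = ‖v‖ :=
  ContinuousLinearMap.norm_map_of_mem_unitary U.2 v

theorem unitary_inner_smul_right (U : UnitaryGp H) (v w : H) :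
    inner ℂ v (U • w) = inner ℂ (U⁻¹ • v) w := by
  rw [← unitary_inner_smul_smul U (U⁻¹ • v), smul_inv_smul]

theorem scalarUnitary_smul (z : Circle) (v : H) : scalarUnitary H z • v = (z : ℂ) • v := rfl

theorem unitary_smul_smul (U : UnitaryGp H) (c : ℂ) (v : H) : U • c • v = c • U • v :=
  map_smul (U : H →L[ℂ] H) c v

theorem unitary_smul_ne_zero (U : UnitaryGp H) {v : H} (hv : v ≠ 0) : U • v ≠ 0 :=
  (smul_ne_zero_iff_ne U).2 hv

variable {G : Type*} [Group G] {ρ : G →* ProjUnitaryGp H}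

theorem rho_sharpProj (γ : GSharp ρ) :
    ρ (sharpProj ρ γ) = (sharpRep ρ γ : ProjUnitaryGp H) := γ.2

theorem rho_smul_mk (γ : GSharp ρ) {v : H} (hv : v ≠ 0) :
    ρ (sharpProj ρ γ) • Projectivization.mk ℂ v hv =
      Projectivization.mk ℂ (sharpRep ρ γ • v) (unitary_smul_ne_zero _ hv) := by
  rw [rho_sharpProj]
  exact projUnitary_smul_mk _ _ _ _

theorem sharpProj_surjective : Function.Surjective (sharpProj ρ) := by
  intro g
  obtain ⟨U, hU⟩ := QuotientGroup.mk_surjective (ρ g)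
  exact ⟨⟨(g, U), hU.symm⟩, rfl⟩

theorem sharp_ext {γ γ' : GSharp ρ} (h : sharpProj ρ γ = sharpProj ρ γ')
    (h' : sharpRep ρ γ = sharpRep ρ γ') : γ = γ' :=
  Subtype.ext (Prod.ext h h')

@[simp]
theorem sharpProj_sharpIncl (z : Circle) : sharpProj ρ (sharpIncl ρ z) = 1 := rfl

@[simp]
theorem sharpRep_sharpIncl (z : Circle) : sharpRep ρ (sharpIncl ρ z) = scalarUnitary H z := rfl

theorem sharpRep_mul_sharpIncl_smul (γ : GSharp ρ) (z : Circle) (v : H) :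
    sharpRep ρ (γ * sharpIncl ρ z) • v = (z : ℂ) • sharpRep ρ γ • v := by
  rw [map_mul, mul_smul, sharpRep_sharpIncl, scalarUnitary_smul, unitary_smul_smul]

theorem exists_eq_mul_sharpIncl {γ γ' : GSharp ρ} (h : sharpProj ρ γ = sharpProj ρ γ') :
    ∃ z, γ' = γ * sharpIncl ρ z := by
  have h1 : (sharpRep ρ γ : ProjUnitaryGp H) = sharpRep ρ γ' := by
    rw [← rho_sharpProj, ← rho_sharpProj, h]
  obtain ⟨z, hz⟩ := QuotientGroup.eq.1 h1
  refine ⟨z, sharp_ext (by simp [h]) ?_⟩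
  rw [map_mul, sharpRep_sharpIncl, hz, mul_inv_cancel_left]

theorem sharpIncl_central (z : Circle) (γ : GSharp ρ) :
    sharpIncl ρ z * γ = γ * sharpIncl ρ z := by
  refine sharp_ext (by simp) ?_
  ext v
  change sharpRep ρ (sharpIncl ρ z * γ) • v = sharpRep ρ (γ * sharpIncl ρ z) • v
  rw [sharpRep_mul_sharpIncl_smul, map_mul, mul_smul]
  rfl

variable {ψ : H} (hψ : ψ ≠ 0)

theorem mem_nonOrthSet_iff (γ : GSharp ρ) :
    sharpProj ρ γ ∈ nonOrthSet ρ (Projectivization.mk ℂ ψ hψ) ↔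
      inner ℂ ψ (sharpRep ρ γ • ψ) ≠ 0 := by
  change ¬ (_ ⟂ _) ↔ _
  rw [rho_smul_mk, Projectivization.submodule_mk, Projectivization.submodule_mk,
    Submodule.isOrtho_span, not_iff_not]
  simp only [mem_singleton_iff, forall_eq]
  exact inner_eq_zero_symm

theorem mem_nonOrthSet_iff_affineDomain (g : G) :
    g ∈ nonOrthSet ρ (Projectivization.mk ℂ ψ hψ) ↔
      ρ g • Projectivization.mk ℂ ψ hψ ∈ affineDomain ψ := by
  obtain ⟨γ, rfl⟩ := sharpProj_surjective (ρ := ρ) g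
  rw [mem_nonOrthSet_iff, rho_smul_mk, mk_mem_affineDomain]

theorem sharpProj_sharpTriv (x : G × Circle) : sharpProj ρ (sharpTriv ρ ψ hψ x) = x.1 := rfl

theorem sharpRep_sharpTriv_smul (x : G × Circle) (v : H) :
    sharpRep ρ (sharpTriv ρ ψ hψ x) • v = (x.2 : ℂ) • normalizedLift ρ ψ hψ x.1 • v := by
  change (normalizedLift ρ ψ hψ x.1 * scalarUnitary H x.2) • v = _
  rw [mul_smul, scalarUnitary_smul, unitary_smul_smul]

theorem sharpRep_sharpTriv_one (g : G) :
    sharpRep ρ (sharpTriv ρ ψ hψ (g, 1)) = normalizedLift ρ ψ hψ g := by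
  change normalizedLift ρ ψ hψ g * scalarUnitary H 1 = _
  rw [map_one, mul_one]

theorem sharpTriv_mul (g : G) (z w : Circle) :
    sharpTriv ρ ψ hψ (g, z * w) = sharpTriv ρ ψ hψ (g, z) * sharpIncl ρ w := by
  refine sharp_ext (by simp [sharpProj_sharpTriv]) ?_
  change normalizedLift ρ ψ hψ g * scalarUnitary H (z * w) = normalizedLift ρ ψ hψ g *
    scalarUnitary H z * scalarUnitary H w
  rw [map_mul, mul_assoc]

theorem isNormalizedLift_normalizedLift {g : G}
    (hg : g ∈ nonOrthSet ρ (Projectivization.mk ℂ ψ hψ)) :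
    IsNormalizedLift ρ ψ g (normalizedLift ρ ψ hψ g) :=
  (exists_normalizedLift ρ ψ hψ g).choose_spec.2 hg

theorem IsNormalizedLift.inner_eq {g : G} {U : UnitaryGp H} (h : IsNormalizedLift ρ ψ g U) :
    inner ℂ ψ (U • ψ) = (‖inner ℂ ψ (U • ψ)‖ : ℝ) ∧ 0 < ‖inner ℂ ψ (U • ψ)‖ := by
  obtain ⟨-, h1, h2⟩ := h
  have h3 : inner ℂ ψ (U • ψ) = ((inner ℂ ψ (U • ψ)).re : ℂ) := by
    apply Complex.ext <;> simp [h2]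
  constructor
  · rw [h3, Complex.norm_real, Real.norm_of_nonneg h1.le]
  · rw [norm_pos_iff]
    intro h0
    rw [h0] at h1
    simp at h1

/-- The inverse of `τ_ψ`. -/
noncomputable def sharpTrivInv (ρ : G →* ProjUnitaryGp H) (ψ : H) (γ : GSharp ρ) : G × Circle :=
  (sharpProj ρ γ, phase (inner ℂ ψ (sharpRep ρ γ • ψ)))

theorem sharpTrivInv_sharpTriv {x : G × Circle}
    (hx : x.1 ∈ nonOrthSet ρ (Projectivization.mk ℂ ψ hψ)) :
    sharpTrivInv ρ ψ (sharpTriv ρ ψ hψ x) = x := by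
  refine Prod.ext rfl ?_
  obtain ⟨h1, h2⟩ := (isNormalizedLift_normalizedLift hψ hx).inner_eq
  change phase _ = x.2
  rw [sharpRep_sharpTriv_smul, inner_smul_right, h1, phase_mul_ofReal _ h2]

/-- The element γ and τ_ψ(g,1) lie in the same 𝕋-orbit, so γ = τ_ψ(g,z) for some z, and the other
inverse identity recovers z. -/
theorem sharpTriv_sharpTrivInv {γ : GSharp ρ}
    (hγ : sharpProj ρ γ ∈ nonOrthSet ρ (Projectivization.mk ℂ ψ hψ)) :
    sharpTriv ρ ψ hψ (sharpTrivInv ρ ψ γ) = γ := by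
  obtain ⟨z, hz⟩ := exists_eq_mul_sharpIncl
    (γ := sharpTriv ρ ψ hψ (sharpProj ρ γ, 1)) (γ' := γ) rfl
  rw [← sharpTriv_mul, one_mul] at hz
  have := sharpTrivInv_sharpTriv hψ (x := (sharpProj ρ γ, z)) hγ
  rw [← hz] at this
  rw [this, ← hz]

/-- A positive number has phase 1, so (g,U) = τ_ψ(g,1). -/
theorem normalizedLift_unique {g : G} {U : UnitaryGp H} (hU : IsNormalizedLift ρ ψ g U) :
    U = normalizedLift ρ ψ hψ g := by
  let γ : GSharp ρ := ⟨(g, U), hU.1.symm⟩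
  obtain ⟨h1, h2⟩ := hU.inner_eq
  have hγ : sharpProj ρ γ ∈ nonOrthSet ρ (Projectivization.mk ℂ ψ hψ) :=
    (mem_nonOrthSet_iff hψ γ).2 (norm_pos_iff.1 h2)
  have h3 : sharpTrivInv ρ ψ γ = (g, 1) := by
    refine Prod.ext rfl ?_
    change phase (inner ℂ ψ (U • ψ)) = 1
    rw [h1]
    simpa using phase_mul_ofReal 1 h2
  have h4 := sharpTriv_sharpTrivInv hψ hγ
  rw [h3] at h4
  rw [← sharpRep_sharpTriv_one, h4]
  rfl

theorem inner_inv_smul (γ : GSharp ρ) (φ : H) :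
    inner ℂ φ (sharpRep ρ γ⁻¹ • φ) = (starRingEnd ℂ) (inner ℂ φ (sharpRep ρ γ • φ)) := by
  rw [inner_conj_symm, unitary_inner_smul_right, map_inv, inv_inv]

theorem inv_mem_nonOrthSet {g : G} (hg : g ∈ nonOrthSet ρ (Projectivization.mk ℂ ψ hψ)) :
    g⁻¹ ∈ nonOrthSet ρ (Projectivization.mk ℂ ψ hψ) := by
  obtain ⟨γ, rfl⟩ := sharpProj_surjective (ρ := ρ) g
  rw [← map_inv, mem_nonOrthSet_iff, inner_inv_smul, Ne, map_eq_zero]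
  exact (mem_nonOrthSet_iff hψ γ).1 hg

theorem one_mem_nonOrthSet : (1 : G) ∈ nonOrthSet ρ (Projectivization.mk ℂ ψ hψ) := by
  rw [← map_one (sharpProj ρ), mem_nonOrthSet_iff]
  simpa using hψ

theorem normalizedLift_inv {g : G} (hg : g ∈ nonOrthSet ρ (Projectivization.mk ℂ ψ hψ)) :
    normalizedLift ρ ψ hψ g⁻¹ = (normalizedLift ρ ψ hψ g)⁻¹ := by
  symm
  apply normalizedLift_unique
  obtain ⟨h1, h2, h3⟩ := isNormalizedLift_normalizedLift hψ hg
  have := inner_inv_smul (sharpTriv ρ ψ hψ (g, 1)) ψ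
  rw [map_inv, sharpRep_sharpTriv_one] at this
  refine ⟨by rw [QuotientGroup.mk_inv, h1, map_inv], ?_, ?_⟩ <;> rw [this]
  · rwa [Complex.conj_re]
  · rw [Complex.conj_im, h3, neg_zero]

/-! ### Smoothness of the normalized lift -/

variable {E : Type*} [AddCommGroup E] [Module ℝ E] [TopologicalSpace E]
  [IsTopologicalAddGroup E] [ContinuousSMul ℝ E] [LocallyConvexSpace ℝ E] [T2Space E]
  [TopologicalSpace G] [ChartedSpace E G]

theorem isOpen_nonOrthSet (h : IsSmoothRay ρ E (Projectivization.mk ℂ ψ hψ)) :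
    IsOpen (nonOrthSet ρ (Projectivization.mk ℂ ψ hψ)) := by
  convert (isOpen_affineDomain ψ).preimage h.1 using 1
  ext g
  exact mem_nonOrthSet_iff_affineDomain hψ g

theorem IsSmoothRay.pSmoothAt (h : IsSmoothRay ρ E (Projectivization.mk ℂ ψ hψ)) (g : G) :
    PSmoothAt E (fun g => ρ g • Projectivization.mk ℂ ψ hψ) g :=
  smoothToProj_iff.1 h g

open scoped ContDiff in
-- With c = ⟨ψ, ρ_ψ(g)ψ⟩ > 0 and u the affine coordinate of the ray, ρ_ψ(g)ψ = (c/‖ψ‖²)(ψ + u).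
-- Comparing norms gives c = ‖ψ‖³/‖ψ + u‖, which is smooth because ψ + u never vanishes.
theorem mSmoothAt_normalizedLift (h : IsSmoothRay ρ E (Projectivization.mk ℂ ψ hψ)) {g : G}
    (hg : g ∈ nonOrthSet ρ (Projectivization.mk ℂ ψ hψ)) :
    MSmoothAt E H (fun g : G => normalizedLift ρ ψ hψ g • ψ) g := by
  have hne : ∀ g, normalizedLift ρ ψ hψ g • ψ ≠ 0 := fun g => unitary_smul_ne_zero _ hψ
  have hmk : ∀ g, ρ g • Projectivization.mk ℂ ψ hψ = Projectivization.mk ℂ _ (hne g) := by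
    intro g
    rw [← coe_normalizedLift ρ ψ hψ g]
    exact projUnitary_smul_mk _ _ _ _
  have hψ' : (0 : ℝ) < ‖ψ‖ := norm_pos_iff.2 hψ
  have hray := h.pSmoothAt hψ g
  simp only [hmk] at hray
  have hin : inner ℂ ψ (normalizedLift ρ ψ hψ g • ψ) ≠ 0 :=
    norm_pos_iff.1 (isNormalizedLift_normalizedLift hψ hg).inner_eq.2
  refine MSmoothAt.of_ray hne hin hray ?_
  have hu := hray.2 ψ hψ ((mk_mem_affineDomain _).2 hin)
  have hsum : ∀ u : (ℂ ∙ ψ)ᗮ, ψ + (u : H) ≠ 0 := by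
    intro u hu0
    have h1 : inner ℂ ψ (u : H) = 0 := Submodule.mem_orthogonal_singleton_iff_inner_right.1 u.2
    have h2 : inner ℂ ψ (ψ + (u : H)) = 0 := by rw [hu0, inner_zero_right]
    rw [inner_add_right, h1, add_zero, inner_self_eq_zero] at h2
    exact hψ h2
  let _ : InnerProductSpace ℝ H := InnerProductSpace.complexToReal
  have hΦ : ContDiff ℝ ∞ fun u : (ℂ ∙ ψ)ᗮ => ((‖ψ‖ ^ 3 / ‖ψ + (u : H)‖ : ℝ) : ℂ) := by
    refine Complex.ofRealCLM.contDiff.comp (contDiff_const.div (ContDiff.norm ℝ ?_ hsum)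
      fun u => norm_ne_zero_iff.2 (hsum u))
    exact contDiff_const.add ((ℂ ∙ ψ)ᗮ.subtypeL.contDiff.restrict_scalars ℝ)
  refine ((hΦ.smoothNear _).compM hu).congr ?_
  filter_upwards [(isOpen_nonOrthSet hψ h).mem_nhds hg] with g' hg'
  obtain ⟨h1, h2⟩ := (isNormalizedLift_normalizedLift hψ hg').inner_eq
  have h3 := eq_smul_add_affineChart (hne g') (norm_pos_iff.1 h2)
  set u := affineChart ψ (Projectivization.mk ℂ _ (hne g'))
  have h4 := congrArg norm h3
  rw [unitary_norm_smul, norm_smul, norm_div, norm_pow, Complex.norm_real, norm_norm] at h4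
  have hs : 0 < ‖ψ + (u : H)‖ := norm_pos_iff.2 (hsum u)
  rw [h1]
  congr 1
  rw [div_eq_iff hs.ne']
  field_simp at h4
  linarith

end Sharp

noncomputable section

/-! ### The Lie group structure of the central extension -/

section LieBasics

variable {E : Type*} [AddCommGroup E] [Module ℝ E] [TopologicalSpace E]
  [IsTopologicalAddGroup E] [ContinuousSMul ℝ E] [LocallyConvexSpace ℝ E] [T2Space E]
variable {E' : Type*} [AddCommGroup E'] [Module ℝ E'] [TopologicalSpace E']
  [IsTopologicalAddGroup E'] [ContinuousSMul ℝ E'] [LocallyConvexSpace ℝ E'] [T2Space E']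
variable {G : Type*} [Group G] [TopologicalSpace G] [ChartedSpace E G] [IsLocConvexLieGroup E G]
variable {M : Type*} [TopologicalSpace M] [ChartedSpace E' M]

theorem MSmoothAt.mul {f g : M → G} {x : M} (hf : MSmoothAt E' E f x) (hg : MSmoothAt E' E g x) :
    MSmoothAt E' E (fun y => f y * g y) x :=
  MSmoothAt.comp (g := fun p : G × G => p.1 * p.2) (f := fun y => (f y, g y))
    (smoothMapOn_univ_iff.1 (IsLocConvexLieGroup.smooth_mul (E := E) (G := G)) (f x, g x))
    (hf.prodMk hg)

theorem MSmoothAt.inv {f : M → G} {x : M} (hf : MSmoothAt E' E f x) :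
    MSmoothAt E' E (fun y => (f y)⁻¹) x :=
  MSmoothAt.comp (g := fun g : G => g⁻¹) (f := f)
    (smoothMapOn_univ_iff.1 (IsLocConvexLieGroup.smooth_inv (E := E) (G := G)) (f x)) hf

theorem isTopologicalGroup_of_isLocConvexLieGroup (E G : Type*) [AddCommGroup E] [Module ℝ E]
    [TopologicalSpace E] [IsTopologicalAddGroup E] [ContinuousSMul ℝ E] [LocallyConvexSpace ℝ E]
    [T2Space E] [Group G] [TopologicalSpace G] [ChartedSpace E G] [IsLocConvexLieGroup E G] :
    IsTopologicalGroup G where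
  continuous_mul := continuousOn_univ.1 (IsLocConvexLieGroup.smooth_mul (E := E) (G := G)).1
  continuous_inv := continuousOn_univ.1 (IsLocConvexLieGroup.smooth_inv (E := E) (G := G)).1

end LieBasics

/-- The generated subgroup is open, hence closed, and a connected group has no proper one of this
kind. -/
theorem closure_eq_top_of_mem_nhds_one {G : Type*} [Group G] [TopologicalSpace G]
    [IsTopologicalGroup G] [ConnectedSpace G] {U : Set G} (hU : U ∈ 𝓝 1) :
    Subgroup.closure U = ⊤ := by
  have hmem : (Subgroup.closure U : Set G) ∈ 𝓝 1 := mem_of_superset hU Subgroup.subset_closure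
  have hopen := Subgroup.isOpen_of_mem_nhds _ hmem
  exact SetLike.coe_injective
    (IsClopen.eq_univ ⟨Subgroup.isClosed_of_isOpen _ hopen, hopen⟩ ⟨1, one_mem _⟩)

section SharpLie

variable {H : Type*} [NormedAddCommGroup H] [InnerProductSpace ℂ H] [CompleteSpace H]
variable {E : Type*} [AddCommGroup E] [Module ℝ E] [TopologicalSpace E]
  [IsTopologicalAddGroup E] [ContinuousSMul ℝ E] [LocallyConvexSpace ℝ E] [T2Space E]
variable {E' : Type*} [AddCommGroup E'] [Module ℝ E'] [TopologicalSpace E']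
  [IsTopologicalAddGroup E'] [ContinuousSMul ℝ E'] [LocallyConvexSpace ℝ E'] [T2Space E']
variable {G : Type*} [Group G] [TopologicalSpace G] [ChartedSpace E G]
variable {M : Type*} [TopologicalSpace M] [ChartedSpace E' M]
variable {ρ : G →* ProjUnitaryGp H} {ψ : H} {hψ : ψ ≠ 0}

theorem MSmoothAt.unitary_smul {f : M → H} {x : M} (hf : MSmoothAt E' H f x) (U : UnitaryGp H) :
    MSmoothAt E' H (fun y => U • f y) x :=
  ((((U : H →L[ℂ] H).restrictScalars ℝ).smoothNear _).compM hf :)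

/-- The ray of the orbit depends only on the projection to G and so varies smoothly; one smooth
nonzero coefficient fixes the remaining scalar. This is the tool for inversion, multiplication and
the orbits of other vectors. -/
theorem IsSmoothRay.mSmoothAt_orbit {φ : H} {hφ : φ ≠ 0}
    (h : IsSmoothRay ρ E (Projectivization.mk ℂ φ hφ)) {f : M → GSharp ρ} {x : M} {χ : H}
    (hf : MSmoothAt E' E (fun y => sharpProj ρ (f y)) x)
    (hχ : inner ℂ χ (sharpRep ρ (f x) • φ) ≠ 0)
    (hin : MSmoothAt E' ℂ (fun y => inner ℂ χ (sharpRep ρ (f y) • φ)) x) :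
    MSmoothAt E' H (fun y => sharpRep ρ (f y) • φ) x := by
  have hray := (h.pSmoothAt hφ (sharpProj ρ (f x))).comp (h := fun y => sharpProj ρ (f y)) hf
  simp only [rho_smul_mk] at hray
  exact MSmoothAt.of_ray _ hχ hray hin

/-- The central extension `G^♯`, as a Lie group by means of the smooth ray `[ψ]`. -/
@[nolint unusedArguments]
def SharpLie (_h : IsSmoothRay ρ E (Projectivization.mk ℂ ψ hψ)) : Type _ := GSharp ρ

variable {h : IsSmoothRay ρ E (Projectivization.mk ℂ ψ hψ)}

namespace SharpLie

instance : Group (SharpLie h) := inferInstanceAs (Group (GSharp ρ))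

/-- The projection to `G`. -/
def proj : SharpLie h →* G := sharpProj ρ

/-- The unitary representation. -/
def rep : SharpLie h →* UnitaryGp H := sharpRep ρ

/-- `G^♯` is the pullback of the sphere bundle over the projective space by the orbit map of `[ψ]`;
it carries the topology of a subset of `G × H`. -/
instance : TopologicalSpace (SharpLie h) :=
  TopologicalSpace.induced (fun γ => (proj γ, rep γ • ψ)) inferInstance

theorem isInducing : Topology.IsInducing fun γ : SharpLie h => (proj γ, rep γ • ψ) := ⟨rfl⟩

theorem continuous_proj : Continuous fun γ : SharpLie h => proj γ :=
  (continuous_prodMk.1 (isInducing (h := h)).continuous).1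

theorem continuous_rep_smul : Continuous fun γ : SharpLie h => rep γ • ψ :=
  (continuous_prodMk.1 (isInducing (h := h)).continuous).2

theorem inner_ne_zero_iff (γ : SharpLie h) : inner ℂ ψ (rep γ • ψ) ≠ 0 ↔
    proj γ ∈ nonOrthSet ρ (Projectivization.mk ℂ ψ hψ) :=
  (mem_nonOrthSet_iff hψ (ρ := ρ) γ).symm

/-- The map `τ_ψ` as a local homeomorphism. -/
def triv : OpenPartialHomeomorph (SharpLie h) (G × Circle) where
  toFun := sharpTrivInv ρ ψ
  invFun := sharpTriv ρ ψ hψ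
  source := proj ⁻¹' nonOrthSet ρ (Projectivization.mk ℂ ψ hψ)
  target := nonOrthSet ρ (Projectivization.mk ℂ ψ hψ) ×ˢ univ
  map_source' _ hγ := ⟨hγ, mem_univ _⟩
  map_target' _ hx := hx.1
  left_inv' _ hγ := sharpTriv_sharpTrivInv hψ hγ
  right_inv' _ hx := sharpTrivInv_sharpTriv hψ hx.1
  open_source := (isOpen_nonOrthSet hψ h).preimage continuous_proj
  open_target := (isOpen_nonOrthSet hψ h).prod isOpen_univ
  continuousOn_toFun γ hγ := by
    have h1 : ContinuousAt (fun γ : SharpLie h => inner ℂ ψ (rep γ • ψ)) γ :=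
      ((innerSL ℂ ψ).continuous.comp continuous_rep_smul).continuousAt
    exact (continuous_proj.continuousAt.prodMk ((continuousAt_phase
      ((inner_ne_zero_iff γ).2 hγ)).comp (f := fun γ : SharpLie h => inner ℂ ψ (rep γ • ψ))
        h1)).continuousWithinAt
  continuousOn_invFun x hx := by
    refine (isInducing.continuousAt_iff.2 (continuousAt_fst.prodMk ?_)).continuousWithinAt
    change ContinuousAt (fun x : G × Circle => sharpRep ρ (sharpTriv ρ ψ hψ x) • ψ) x
    simp only [sharpRep_sharpTriv_smul]
    exact (isInducing_circle_coe.continuous.comp continuous_snd).continuousAt.smul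
      ((mSmoothAt_normalizedLift hψ h hx.1).1.comp (f := Prod.fst) continuousAt_fst)

theorem triv_apply (γ : SharpLie h) : triv γ = (proj γ, phase (inner ℂ ψ (rep γ • ψ))) := rfl

theorem rep_triv_symm_smul (x : G × Circle) :
    rep ((triv (h := h)).symm x) • ψ = (x.2 : ℂ) • normalizedLift ρ ψ hψ x.1 • ψ :=
  sharpRep_sharpTriv_smul hψ x ψ

theorem mem_triv_source {γ : SharpLie h} :
    γ ∈ triv.source ↔ proj γ ∈ nonOrthSet ρ (Projectivization.mk ℂ ψ hψ) := Iff.rfl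

theorem one_mem_triv_source : (1 : SharpLie h) ∈ triv.source := by
  rw [mem_triv_source, map_one]
  exact one_mem_nonOrthSet hψ

/-! ### Left translations, charts and the smoothness criterion -/

variable [IsLocConvexLieGroup E G]

theorem continuous_mul_left (γ₀ : SharpLie h) : Continuous fun γ => γ₀ * γ := by
  have := isTopologicalGroup_of_isLocConvexLieGroup E G
  refine isInducing.continuous_iff.2 ?_
  simp only [Function.comp_def, map_mul, mul_smul]
  exact (continuous_const.mul continuous_proj).prodMk
    ((rep γ₀ : H →L[ℂ] H).continuous.comp continuous_rep_smul)

/-- Left translations are homeomorphisms. -/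
def mulLeft (γ₀ : SharpLie h) : SharpLie h ≃ₜ SharpLie h where
  toEquiv := Equiv.mulLeft γ₀
  continuous_toFun := continuous_mul_left γ₀
  continuous_invFun := continuous_mul_left γ₀⁻¹

/-- The charts of `G^♯`. -/
def chart (γ₀ : SharpLie h) (e : OpenPartialHomeomorph (G × Circle) (E × CircleModel)) :
    OpenPartialHomeomorph (SharpLie h) (E × CircleModel) :=
  (mulLeft γ₀).symm.transOpenPartialHomeomorph (triv.trans e)

/-- The source of `triv` contains 1, so its left translates cover G^♯. -/
instance : ChartedSpace (E × CircleModel) (SharpLie h) where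
  atlas := {f | ∃ γ₀, ∃ e ∈ atlas (E × CircleModel) (G × Circle), f = chart γ₀ e}
  chartAt γ := chart γ (chartAt (E × CircleModel) (triv (1 : SharpLie h)))
  mem_chart_source γ := by
    change (γ⁻¹ * γ ∈ triv.source) ∧ triv (γ⁻¹ * γ) ∈
      (chartAt (E × CircleModel) (triv (1 : SharpLie h))).source
    rw [inv_mul_cancel]
    exact ⟨one_mem_triv_source, mem_chart_source _ _⟩
  chart_mem_atlas γ := ⟨γ, _, chart_mem_atlas _ _, rfl⟩

theorem mSmoothAt_proj (γ : SharpLie h) :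
    MSmoothAt (E × CircleModel) E (proj : SharpLie h → G) γ := by
  refine ⟨continuous_proj.continuousAt, ?_⟩
  rintro _ ⟨γ₀, e, he, rfl⟩ hγ e' he' hγ'
  have h1 : MSmoothAt (E × CircleModel) E (fun x : G × Circle => proj γ₀ * x.1)
      (triv (γ₀⁻¹ * γ)) := (MSmoothAt.const _ _).mul (MSmoothAt.fst _)
  refine h1.2 e he hγ.2 e' he' ?_
  rw [triv_apply]
  simpa using hγ'

/-- In the chart translated by γ₀ the orbit map reads (g,z) ↦ γ₀(z ρ_ψ(g)ψ), a fixed unitary applied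
to a smooth map. -/
theorem mSmoothAt_rep_smul (γ : SharpLie h) :
    MSmoothAt (E × CircleModel) H (fun γ : SharpLie h => rep γ • ψ) γ := by
  refine mSmoothAt_vec_iff.2 ⟨continuous_rep_smul.continuousAt, ?_⟩
  rintro _ ⟨γ₀, e, he, rfl⟩ hγ
  have h1 : MSmoothAt (E × CircleModel) H
      (fun x : G × Circle => rep γ₀ • ((x.2 : ℂ) • normalizedLift ρ ψ hψ x.1 • ψ))
      (triv (γ₀⁻¹ * γ)) := by
    refine MSmoothAt.unitary_smul ?_ _
    exact SmoothNear.compM₂ (Φ := fun p : ℂ × H => p.1 • p.2)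
      ((contDiff_fst.smul contDiff_snd).smoothNear _) (MSmoothAt.snd _).circle_coe
      (MSmoothAt.comp (g := fun g : G => normalizedLift ρ ψ hψ g • ψ) (f := Prod.fst)
        (mSmoothAt_normalizedLift hψ h hγ.1) (MSmoothAt.fst _))
  refine ((mSmoothAt_vec_iff.1 h1).2 e he hγ.2).congr (Eventually.of_forall fun y => ?_)
  simp only [← rep_triv_symm_smul (h := h), ← mul_smul, ← map_mul]
  rfl

/-- Smoothness of maps into `G^♯` can be tested after projection to `G` and on the orbit of
`ψ`. -/
theorem mSmoothAt_of {f : M → SharpLie h} {x : M} (h1 : MSmoothAt E' E (fun y => proj (f y)) x)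
    (h2 : MSmoothAt E' H (fun y => rep (f y) • ψ) x) : MSmoothAt E' (E × CircleModel) f x := by
  refine ⟨isInducing.continuousAt_iff.2 (h1.1.prodMk h2.1), fun e he hx => ?_⟩
  rintro _ ⟨γ₀, e', he', rfl⟩ hx'
  have h3 : MSmoothAt E' (E × CircleModel) (fun y => triv (γ₀⁻¹ * f y)) x := by
    have hne := (inner_ne_zero_iff _).2 (mem_triv_source.1 hx'.1)
    simp only [triv_apply]
    refine MSmoothAt.prodMk ?_ (MSmoothAt.phase ?_ hne)
    · simp only [map_mul]
      exact (MSmoothAt.const _ _).mul h1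
    · simp only [map_mul, mul_smul]
      exact (h2.unitary_smul _).inner_const ψ
  exact h3.2 e he hx e' he' hx'.2

instance : SmoothMfd (E × CircleModel) (SharpLie h) where
  compatible e he e' he' := by
    have h : ∀ γ : SharpLie h, MSmoothAt (E × CircleModel) (E × CircleModel)
        (fun y : SharpLie h => y) γ := fun γ => mSmoothAt_of (mSmoothAt_proj γ)
          (mSmoothAt_rep_smul γ)
    have := (smoothMapOn_univ_iff.2 h).2 e he e' he'
    simpa using this

/-! ### Smoothness of the group operations -/

theorem mSmoothAt_mul_left (γ₀ γ : SharpLie h) :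
    MSmoothAt (E × CircleModel) (E × CircleModel) (fun γ : SharpLie h => γ₀ * γ) γ := by
  apply mSmoothAt_of
  · simp only [map_mul]
    exact (MSmoothAt.const _ _).mul (mSmoothAt_proj γ)
  · simp only [map_mul, mul_smul]
    exact (mSmoothAt_rep_smul γ).unitary_smul _

theorem _root_.MSmoothAt.conj {f : M → ℂ} {x : M} (hf : MSmoothAt E' ℂ f x) :
    MSmoothAt E' ℂ (fun y => (starRingEnd ℂ) (f y)) x :=
  ((Complex.conjCLE.contDiff.smoothNear _).compM hf :)

/-- The coefficient ⟨ψ, γ⁻¹ψ⟩ is the conjugate of ⟨ψ, γψ⟩, hence smooth; over U_ψ it is nonzero,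
which is why inversion is treated only there at first. -/
theorem mSmoothAt_inv_of_mem {γ : SharpLie h} (hγ : γ ∈ triv.source) :
    MSmoothAt (E × CircleModel) (E × CircleModel) (fun γ : SharpLie h => γ⁻¹) γ := by
  have h1 : MSmoothAt (E × CircleModel) E (fun γ : SharpLie h => proj γ⁻¹) γ := by
    simp only [map_inv]
    exact (mSmoothAt_proj γ).inv
  have hinv : ∀ γ : SharpLie h,
      inner ℂ ψ (rep γ⁻¹ • ψ) = (starRingEnd ℂ) (inner ℂ ψ (rep γ • ψ)) := fun γ =>
    inner_inv_smul (ρ := ρ) γ ψ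
  refine mSmoothAt_of h1 (h.mSmoothAt_orbit (f := fun γ : SharpLie h => γ⁻¹) (χ := ψ) h1 ?_ ?_)
  · change inner ℂ ψ (rep γ⁻¹ • ψ) ≠ 0
    rw [hinv, Ne, map_eq_zero]
    exact (inner_ne_zero_iff γ).2 hγ
  · change MSmoothAt _ _ (fun γ : SharpLie h => inner ℂ ψ (rep γ⁻¹ • ψ)) γ
    simp only [hinv]
    exact ((mSmoothAt_rep_smul γ).inner_const ψ).conj

theorem of_mSmoothAt_one {Z : Type*} [AddCommGroup Z] [Module ℝ Z] [TopologicalSpace Z]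
    [IsTopologicalAddGroup Z] [ContinuousSMul ℝ Z] [LocallyConvexSpace ℝ Z] [T2Space Z]
    {N : Type*} [TopologicalSpace N] [ChartedSpace Z N] {f : SharpLie h → N} {γ : SharpLie h}
    (hf : MSmoothAt (E × CircleModel) Z (fun δ => f (γ * δ)) 1) :
    MSmoothAt (E × CircleModel) Z f γ := by
  have h1 := mSmoothAt_mul_left γ⁻¹ γ
  have h2 : MSmoothAt (E × CircleModel) Z (fun δ => f (γ * δ)) (γ⁻¹ * γ) := by
    rwa [inv_mul_cancel]
  simpa using h2.comp h1

/-- Vectors with a smooth ray that are not orthogonal to `ψ` have a smooth orbit map. -/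
theorem mSmoothAt_rep_smul_of_ray {φ : H} {hφ : φ ≠ 0}
    (hray : IsSmoothRay ρ E (Projectivization.mk ℂ φ hφ)) (hin : inner ℂ ψ φ ≠ 0)
    (γ : SharpLie h) : MSmoothAt (E × CircleModel) H (fun γ : SharpLie h => rep γ • φ) γ := by
  refine of_mSmoothAt_one ?_
  simp only [map_mul, mul_smul]
  refine MSmoothAt.unitary_smul ?_ _
  refine hray.mSmoothAt_orbit (f := fun γ : SharpLie h => γ) (χ := ψ) (mSmoothAt_proj 1) ?_ ?_
  · change inner ℂ ψ (rep (1 : SharpLie h) • φ) ≠ 0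
    rwa [map_one, one_smul]
  · have h1 := (((mSmoothAt_rep_smul _).comp
      (mSmoothAt_inv_of_mem (one_mem_triv_source (h := h)))).inner_const φ).conj
    refine h1.congr (Eventually.of_forall fun γ => ?_)
    change (starRingEnd ℂ) (inner ℂ φ (rep γ⁻¹ • ψ)) = inner ℂ ψ (rep γ • φ)
    rw [inner_conj_symm, map_inv, unitary_inner_smul_right]

/-- Right translation by γ₁ replaces the orbit of ψ by that of γ₁ψ. The ray of γ₁ψ is smooth, its
orbit map being a right translate of that of [ψ], and γ₁ψ is not orthogonal to ψ precisely because
γ₁ lies over U_ψ. -/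
theorem mSmoothAt_mul_right_of_mem {γ₁ : SharpLie h} (hγ₁ : γ₁ ∈ triv.source) (γ : SharpLie h) :
    MSmoothAt (E × CircleModel) (E × CircleModel) (fun γ : SharpLie h => γ * γ₁) γ := by
  apply mSmoothAt_of
  · simp only [map_mul]
    exact (mSmoothAt_proj γ).mul (MSmoothAt.const _ _)
  · simp only [map_mul, mul_smul]
    have hne : rep γ₁ • ψ ≠ 0 := unitary_smul_ne_zero _ hψ
    refine mSmoothAt_rep_smul_of_ray (hφ := hne) (smoothToProj_iff.2 fun g => ?_)
      ((inner_ne_zero_iff γ₁).2 hγ₁) γ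
    have h1 : (fun g => ρ g • Projectivization.mk ℂ (rep γ₁ • ψ) hne) =
        fun g => ρ (g * proj γ₁) • Projectivization.mk ℂ ψ hψ := by
      ext g : 1
      rw [map_mul, mul_smul]
      congr 1
      exact (rho_smul_mk (ρ := ρ) γ₁ hψ).symm
    rw [h1]
    exact (h.pSmoothAt hψ (g * proj γ₁)).comp (h := fun g => g * proj γ₁)
      ((MSmoothAt.id g).mul (MSmoothAt.const _ _))

variable [ConnectedSpace G]

/-- Compositions of smooth right translations are smooth, and the symmetric neighbourhood U_ψ
generates the connected group G. -/
theorem mSmoothAt_mul_right (γ₁ γ : SharpLie h) :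
    MSmoothAt (E × CircleModel) (E × CircleModel) (fun γ : SharpLie h => γ * γ₁) γ := by
  have := isTopologicalGroup_of_isLocConvexLieGroup E G
  -- Quantifying over all lifts of g allows the induction to run in G, where connectedness is
  -- available.
  let P (g : G) : Prop := ∀ γ₁ : SharpLie h, proj γ₁ = g → ∀ γ,
    MSmoothAt (E × CircleModel) (E × CircleModel) (fun γ : SharpLie h => γ * γ₁) γ
  have hP : ∀ g ∈ nonOrthSet ρ (Projectivization.mk ℂ ψ hψ), P g := fun g hg γ₁ hγ₁ =>
    mSmoothAt_mul_right_of_mem (mem_triv_source.2 (hγ₁ ▸ hg))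
  have hmul : ∀ g g', P g → P g' → P (g * g') := by
    intro g g' hg hg' γ₁ hγ₁ γ
    obtain ⟨γ₂, hγ₂⟩ : ∃ γ₂ : SharpLie h, proj γ₂ = g := sharpProj_surjective g
    have h1 := (hg' (γ₂⁻¹ * γ₁) (by simp [hγ₁, hγ₂]) (γ * γ₂)).comp
      (f := fun γ : SharpLie h => γ * γ₂) (hg γ₂ hγ₂ γ)
    simpa [mul_assoc] using h1
  -- Smoothness of a right translation does not formally give that of its inverse, so both are
  -- carried along, starting from the symmetry of U_ψ.
  have key : ∀ g : G, P g ∧ P g⁻¹ := by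
    intro g
    have hg : g ∈ Subgroup.closure (nonOrthSet ρ (Projectivization.mk ℂ ψ hψ)) := by
      rw [closure_eq_top_of_mem_nhds_one
        ((isOpen_nonOrthSet hψ h).mem_nhds (one_mem_nonOrthSet hψ))]
      trivial
    induction hg using Subgroup.closure_induction with
    | mem g hg => exact ⟨hP g hg, hP _ (inv_mem_nonOrthSet hψ hg)⟩
    | one => simpa using hP 1 (one_mem_nonOrthSet hψ)
    | mul g g' _ _ hg hg' => exact ⟨hmul _ _ hg.1 hg'.1, by
        rw [mul_inv_rev]
        exact hmul _ _ hg'.2 hg.2⟩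
    | inv g _ hg => exact ⟨hg.2, by rw [inv_inv]; exact hg.1⟩
  exact (key (proj γ₁)).1 γ₁ rfl γ

/-- Since (γδ)⁻¹ = δ⁻¹γ⁻¹, inversion near γ is inversion near 1 followed by a right translation. -/
theorem mSmoothAt_inv (γ : SharpLie h) :
    MSmoothAt (E × CircleModel) (E × CircleModel) (fun γ : SharpLie h => γ⁻¹) γ := by
  refine of_mSmoothAt_one ?_
  simp only [mul_inv_rev]
  exact (mSmoothAt_mul_right γ⁻¹ _).comp (mSmoothAt_inv_of_mem one_mem_triv_source)

/-- The coefficient ⟨ψ, γδψ⟩ = ⟨γ⁻¹ψ, δψ⟩ is smooth in both variables and equals ‖ψ‖² at (1,1). -/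
theorem mSmoothAt_mul_one : MSmoothAt ((E × CircleModel) × (E × CircleModel)) (E × CircleModel)
    (fun p : SharpLie h × SharpLie h => p.1 * p.2) (1, 1) := by
  have h1 : MSmoothAt ((E × CircleModel) × (E × CircleModel)) E
      (fun p : SharpLie h × SharpLie h => proj (p.1 * p.2)) (1, 1) := by
    simp only [map_mul]
    exact ((mSmoothAt_proj _).comp (MSmoothAt.fst _)).mul
      ((mSmoothAt_proj _).comp (MSmoothAt.snd _))
  refine mSmoothAt_of h1 (h.mSmoothAt_orbit (f := fun p : SharpLie h × SharpLie h => p.1 * p.2)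
    (χ := ψ) h1 ?_ ?_)
  · change inner ℂ ψ (rep ((1 : SharpLie h) * 1) • ψ) ≠ 0
    simpa using hψ
  · have h2 := (mSmoothAt_rep_smul (h := h) _).comp ((mSmoothAt_inv (h := h) _).comp
      (MSmoothAt.fst (E := E × CircleModel) (F := E × CircleModel) (1, (1 : SharpLie h))))
    have h3 := (mSmoothAt_rep_smul (h := h) _).comp
      (MSmoothAt.snd (E := E × CircleModel) (F := E × CircleModel) ((1 : SharpLie h), 1))
    refine (SmoothNear.compM₂ (Φ := fun p : H × H => inner ℂ p.1 p.2)
      (contDiff_inner.smoothNear _) h2 h3).congr (Eventually.of_forall fun p => ?_)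
    change inner ℂ (rep p.1⁻¹ • ψ) (rep p.2 • ψ) = inner ℂ ψ (rep (p.1 * p.2) • ψ)
    rw [map_mul, mul_smul, map_inv, ← unitary_inner_smul_right]

instance : IsLocConvexLieGroup (E × CircleModel) (SharpLie h) where
  compatible := SmoothMfd.compatible
  smooth_inv := smoothMapOn_univ_iff.2 mSmoothAt_inv
  smooth_mul := smoothMapOn_univ_iff.2 fun p => by
    have h1 : MSmoothAt ((E × CircleModel) × (E × CircleModel)) (E × CircleModel)
        (fun q : SharpLie h × SharpLie h => p.1⁻¹ * q.1) p :=
      (mSmoothAt_mul_left p.1⁻¹ p.1).comp (MSmoothAt.fst p)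
    have h2 : MSmoothAt ((E × CircleModel) × (E × CircleModel)) (E × CircleModel)
        (fun q : SharpLie h × SharpLie h => q.2 * p.2⁻¹) p :=
      (mSmoothAt_mul_right p.2⁻¹ p.2).comp (MSmoothAt.snd p)
    have h3 : MSmoothAt ((E × CircleModel) × (E × CircleModel)) (E × CircleModel)
        (fun p : SharpLie h × SharpLie h => p.1 * p.2) (p.1⁻¹ * p.1, p.2 * p.2⁻¹) := by
      rw [inv_mul_cancel, mul_inv_cancel]
      exact mSmoothAt_mul_one
    -- With p = (γ₀,δ₀), write γδ = γ₀((γ₀⁻¹γ)(δδ₀⁻¹))δ₀ to reduce to the point (1,1).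
    have h4 := (mSmoothAt_mul_right (h := h) p.2 _).comp ((mSmoothAt_mul_left (h := h) p.1 _).comp
      (MSmoothAt.comp (g := fun p : SharpLie h × SharpLie h => p.1 * p.2)
        (f := fun q : SharpLie h × SharpLie h => (p.1⁻¹ * q.1, q.2 * p.2⁻¹)) h3 (h1.prodMk h2)))
    simpa [mul_assoc] using h4

end SharpLie

end SharpLie

/-! ### Adapted Lie group structures -/

section Adapted

theorem mSmoothAt_of_mul_left {E : Type*} [AddCommGroup E] [Module ℝ E] [TopologicalSpace E]
    [IsTopologicalAddGroup E] [ContinuousSMul ℝ E] [LocallyConvexSpace ℝ E] [T2Space E]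
    {G : Type*} [Group G] [TopologicalSpace G] [ChartedSpace E G] [IsLocConvexLieGroup E G]
    {Z : Type*} [AddCommGroup Z] [Module ℝ Z] [TopologicalSpace Z]
    [IsTopologicalAddGroup Z] [ContinuousSMul ℝ Z] [LocallyConvexSpace ℝ Z] [T2Space Z]
    {N : Type*} [TopologicalSpace N] [ChartedSpace Z N] {f : G → N} {g : G}
    (hf : MSmoothAt E Z (fun x => f (g * x)) 1) : MSmoothAt E Z f g := by
  have h2 : MSmoothAt E Z (fun x => f (g * x)) (g⁻¹ * g) := by rwa [inv_mul_cancel]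
  have h3 := h2.comp (f := fun x => g⁻¹ * x) ((MSmoothAt.const g⁻¹ g).mul (MSmoothAt.id g))
  simpa using h3

variable {H : Type w} [NormedAddCommGroup H] [InnerProductSpace ℂ H] [CompleteSpace H]
variable {E : Type u} [AddCommGroup E] [Module ℝ E] [TopologicalSpace E]
  [IsTopologicalAddGroup E] [ContinuousSMul ℝ E] [LocallyConvexSpace ℝ E] [T2Space E]
variable {G : Type v} [Group G] [TopologicalSpace G] [ChartedSpace E G]
variable {ρ : G →* ProjUnitaryGp H} {ψ : H} {hψ : ψ ≠ 0}

/-- An element of `G^♯`, as an element of the Lie group obtained from the smooth ray `[ψ]`. -/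
def toSharpLie (h : IsSmoothRay ρ E (Projectivization.mk ℂ ψ hψ)) (γ : GSharp ρ) : SharpLie h := γ

variable {h : IsSmoothRay ρ E (Projectivization.mk ℂ ψ hψ)}

theorem SharpLie.mSmoothAt_triv_symm [IsLocConvexLieGroup E G] {x : G × Circle}
    (hx : x.1 ∈ nonOrthSet ρ (Projectivization.mk ℂ ψ hψ)) :
    MSmoothAt (E × CircleModel) (E × CircleModel) (triv (h := h)).symm x := by
  refine mSmoothAt_of (MSmoothAt.fst x) ?_
  simp only [rep_triv_symm_smul]
  exact SmoothNear.compM₂ (Φ := fun p : ℂ × H => p.1 • p.2)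
    ((contDiff_fst.smul contDiff_snd).smoothNear _) (MSmoothAt.snd _).circle_coe
    (MSmoothAt.comp (g := fun g : G => normalizedLift ρ ψ hψ g • ψ) (f := Prod.fst)
      (mSmoothAt_normalizedLift hψ h hx) (MSmoothAt.fst _))

theorem SharpLie.mSmoothAt_triv [IsLocConvexLieGroup E G] {γ : SharpLie h} (hγ : γ ∈ triv.source) :
    MSmoothAt (E × CircleModel) (E × CircleModel) (triv (h := h)) γ :=
  (mSmoothAt_proj γ).prodMk
    (((mSmoothAt_rep_smul γ).inner_const ψ).phase ((inner_ne_zero_iff γ).2 hγ))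

variable (h) in
/-- The Lie group structure `L` coincides with the one obtained from the smooth ray `[ψ]`. -/
def IsIsoSharpLie [IsLocConvexLieGroup E G] (L : LieGroupStructure.{u} (GSharp ρ)) : Prop :=
  (∀ γ : L.Carrier, MSmoothAt L.Model (E × CircleModel) (fun γ : L.Carrier => toSharpLie h γ) γ) ∧
  ∀ γ : SharpLie h, MSmoothAt (E × CircleModel) L.Model (fun γ : SharpLie h => L.toCarrier γ) γ

variable [IsLocConvexLieGroup E G] {L L' : LieGroupStructure.{u} (GSharp ρ)}

/-- Both structures make τ_ψ a diffeomorphism onto a neighbourhood of 1, so the identity is smooth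
near 1 in both directions; left translations, smooth for both, carry this to every point. -/
theorem IsAdapted.isIsoSharpLie [ConnectedSpace G] (hL : IsAdapted ρ E ψ hψ L) :
    IsIsoSharpLie h L := by
  obtain ⟨O, hO, hτ, hmap, k, hk, hkmap, hleft, hright⟩ := hL
  have hU := (isOpen_nonOrthSet hψ h).prod (isOpen_univ (X := Circle))
  have h1s := (SharpLie.triv (h := h)).map_source SharpLie.one_mem_triv_source
  have h1 : L.toCarrier (sharpTriv ρ ψ hψ (SharpLie.triv (1 : SharpLie h))) = 1 :=
    (SharpLie.triv (h := h)).left_inv SharpLie.one_mem_triv_source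
  have h1O : (1 : L.Carrier) ∈ O := h1 ▸ hmap h1s
  constructor
  · intro γ
    refine mSmoothAt_of_mul_left ?_
    change MSmoothAt L.Model (E × CircleModel)
      (fun δ : L.Carrier => toSharpLie h γ * toSharpLie h δ) 1
    refine (MSmoothAt.const _ _).mul ?_
    have h2 := (SharpLie.mSmoothAt_triv_symm (h := h) (hkmap h1O).1).comp (hk.mSmoothAt hO h1O)
    refine h2.congr ?_
    filter_upwards [hO.mem_nhds h1O] with δ hδ
    exact hright hδ
  · intro γ
    refine mSmoothAt_of_mul_left ?_
    change MSmoothAt (E × CircleModel) L.Model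
      (fun δ : SharpLie h => L.toCarrier γ * L.toCarrier δ) 1
    refine (MSmoothAt.const _ _).mul ?_
    have h2 := (hτ.mSmoothAt hU h1s).comp
      (SharpLie.mSmoothAt_triv (SharpLie.one_mem_triv_source (h := h)))
    refine h2.congr ?_
    filter_upwards [(SharpLie.triv (h := h)).open_source.mem_nhds SharpLie.one_mem_triv_source]
      with δ hδ
    exact (SharpLie.triv (h := h)).left_inv hδ

theorem IsIsoSharpLie.coincide (hL : IsIsoSharpLie h L) (hL' : IsIsoSharpLie h L') :
    L.Coincide L' :=
  ⟨smoothMapOn_univ_iff.2 fun γ => (hL'.2 _).comp (hL.1 γ), mapsTo_univ _ _,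
    fun γ : L'.Carrier => L.toCarrier γ,
    smoothMapOn_univ_iff.2 fun γ => (hL.2 _).comp (hL'.1 γ), mapsTo_univ _ _,
    fun _ _ => rfl, fun _ _ => rfl⟩

/-- By the criterion for maps into the group built from [φ], only the orbit map of φ has to be
smooth for the structure of [ψ]. -/
theorem mSmoothAt_toSharpLie {φ : H} {hφ : φ ≠ 0}
    (h' : IsSmoothRay ρ E (Projectivization.mk ℂ φ hφ)) (hin : inner ℂ ψ φ ≠ 0) (γ : SharpLie h) :
    MSmoothAt (E × CircleModel) (E × CircleModel) (fun γ : SharpLie h => toSharpLie h' γ) γ :=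
  SharpLie.mSmoothAt_of (SharpLie.mSmoothAt_proj γ) (SharpLie.mSmoothAt_rep_smul_of_ray h' hin γ)

/-- Smooth rays that are not orthogonal yield the same Lie group structure. -/
theorem IsIsoSharpLie.of_inner_ne_zero (hL : IsIsoSharpLie h L) {φ : H} {hφ : φ ≠ 0}
    (h' : IsSmoothRay ρ E (Projectivization.mk ℂ φ hφ)) (hin : inner ℂ ψ φ ≠ 0) :
    IsIsoSharpLie h' L :=
  ⟨fun γ => (mSmoothAt_toSharpLie h' hin _).comp (hL.1 γ), fun γ => (hL.2 _).comp
    (mSmoothAt_toSharpLie h (fun h0 => hin (inner_eq_zero_symm.1 h0)) γ)⟩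

/-- The rays orthogonal to neither ψ nor φ form a nonempty open set. A smooth ray in it links the
two structures in two non-orthogonal steps. -/
theorem IsIsoSharpLie.of_dense (hL : IsIsoSharpLie h L)
    (hd : Dense {p : ℙ ℂ H | IsSmoothRay ρ E p}) {φ : H} {hφ : φ ≠ 0}
    (h' : IsSmoothRay ρ E (Projectivization.mk ℂ φ hφ)) : IsIsoSharpLie h' L := by
  have hne : (affineDomain ψ ∩ affineDomain φ).Nonempty := by
    -- Orthogonal vectors have the common witness ψ + φ; otherwise [φ] itself serves.
    by_cases h0 : inner ℂ ψ φ = 0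
    · have h0' : inner ℂ φ ψ = 0 := inner_eq_zero_symm.1 h0
      have h1 : inner ℂ ψ (ψ + φ) ≠ 0 := by
        rw [inner_add_right, h0, add_zero]
        exact inner_self_ne_zero.2 hψ
      have h2 : inner ℂ φ (ψ + φ) ≠ 0 := by
        rw [inner_add_right, h0', zero_add]
        exact inner_self_ne_zero.2 hφ
      have h3 : ψ + φ ≠ 0 := by
        intro h3
        simp [h3] at h1
      exact ⟨Projectivization.mk ℂ _ h3, (mk_mem_affineDomain h3).2 h1,
        (mk_mem_affineDomain h3).2 h2⟩
    · exact ⟨Projectivization.mk ℂ φ hφ, (mk_mem_affineDomain hφ).2 h0,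
        (mk_mem_affineDomain hφ).2 (inner_self_ne_zero.2 hφ)⟩
  obtain ⟨p, ⟨hp1, hp2⟩, hp⟩ := hd.inter_open_nonempty _
    ((isOpen_affineDomain ψ).inter (isOpen_affineDomain φ)) hne
  have hp : IsSmoothRay ρ E (Projectivization.mk ℂ p.rep p.rep_nonzero) := by
    rwa [Projectivization.mk_rep]
  exact (hL.of_inner_ne_zero hp hp1).of_inner_ne_zero h'
    fun h0 => hp2 (inner_eq_zero_symm.1 h0)

theorem IsIsoSharpLie.mSmoothAt_sharpProj (hL : IsIsoSharpLie h L) (γ : L.Carrier) :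
    MSmoothAt L.Model E (fun γ : L.Carrier => sharpProj ρ γ) γ :=
  (SharpLie.mSmoothAt_proj (toSharpLie h γ)).comp (hL.1 γ)

theorem IsIsoSharpLie.isSmoothVector (hL : IsIsoSharpLie h L) : IsSmoothVector ρ L ψ :=
  smoothMapOn_univ_iff.2 fun γ => (SharpLie.mSmoothAt_rep_smul (toSharpLie h γ)).comp (hL.1 γ)

theorem IsIsoSharpLie.mSmoothAt_sharpIncl (hL : IsIsoSharpLie h L) (z : Circle) :
    MSmoothAt CircleModel L.Model (fun z => L.toCarrier (sharpIncl ρ z)) z := by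
  refine (hL.2 _).comp (f := fun z => toSharpLie h (sharpIncl ρ z)) ?_
  refine SharpLie.mSmoothAt_of (MSmoothAt.const 1 z) ?_
  exact SmoothNear.compM (Φ := fun c : ℂ => c • ψ) ((contDiff_id.smul contDiff_const).smoothNear _)
    (mSmoothAt_circle_coe z)

/-! ### The principal bundle -/

/-- The local trivialization of `G^♯` around the image of `γ₀` in `G`. -/
def localTriv (hψ : ψ ≠ 0) (γ₀ : GSharp ρ) (x : G × Circle) : GSharp ρ :=
  γ₀ * sharpTriv ρ ψ hψ ((sharpProj ρ γ₀)⁻¹ * x.1, x.2)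

theorem sharpProj_localTriv (γ₀ : GSharp ρ) (x : G × Circle) :
    sharpProj ρ (localTriv hψ γ₀ x) = x.1 := by
  rw [localTriv, map_mul, sharpProj_sharpTriv, mul_inv_cancel_left]

/-- The inverse of the local trivialization. -/
def localTrivInv (ψ : H) (γ₀ γ : GSharp ρ) : G × Circle :=
  (sharpProj ρ γ, (sharpTrivInv ρ ψ (γ₀⁻¹ * γ)).2)

theorem localTrivInv_localTriv (γ₀ : GSharp ρ) {x : G × Circle}
    (hx : (sharpProj ρ γ₀)⁻¹ * x.1 ∈ nonOrthSet ρ (Projectivization.mk ℂ ψ hψ)) :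
    localTrivInv ψ γ₀ (localTriv hψ γ₀ x) = x := by
  refine Prod.ext (sharpProj_localTriv γ₀ x) ?_
  have h1 : γ₀⁻¹ * localTriv hψ γ₀ x =
      sharpTriv ρ ψ hψ ((sharpProj ρ γ₀)⁻¹ * x.1, x.2) := inv_mul_cancel_left _ _
  change (sharpTrivInv ρ ψ (γ₀⁻¹ * localTriv hψ γ₀ x)).2 = x.2
  rw [h1, sharpTrivInv_sharpTriv hψ (x := ((sharpProj ρ γ₀)⁻¹ * x.1, x.2)) hx]

theorem localTriv_localTrivInv {γ₀ γ : GSharp ρ}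
    (hγ : sharpProj ρ (γ₀⁻¹ * γ) ∈ nonOrthSet ρ (Projectivization.mk ℂ ψ hψ)) :
    localTriv hψ γ₀ (localTrivInv ψ γ₀ γ) = γ := by
  have h2 : ((sharpProj ρ γ₀)⁻¹ * sharpProj ρ γ, (sharpTrivInv ρ ψ (γ₀⁻¹ * γ)).2) =
      sharpTrivInv ρ ψ (γ₀⁻¹ * γ) := by
    refine Prod.ext ?_ rfl
    change _ = sharpProj ρ (γ₀⁻¹ * γ)
    rw [map_mul, map_inv]
  change γ₀ * sharpTriv ρ ψ hψ
    ((sharpProj ρ γ₀)⁻¹ * sharpProj ρ γ, (sharpTrivInv ρ ψ (γ₀⁻¹ * γ)).2) = γ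
  rw [h2, sharpTriv_sharpTrivInv hψ hγ, mul_inv_cancel_left]

theorem IsIsoSharpLie.mSmoothAt_localTriv (hL : IsIsoSharpLie h L) (γ₀ : GSharp ρ)
    {x : G × Circle}
    (hx : (sharpProj ρ γ₀)⁻¹ * x.1 ∈ nonOrthSet ρ (Projectivization.mk ℂ ψ hψ)) :
    MSmoothAt (E × CircleModel) L.Model (fun x => L.toCarrier (localTriv hψ γ₀ x)) x := by
  refine (MSmoothAt.const (L.toCarrier γ₀) x).mul ?_
  refine (hL.2 _).comp (f := fun x : G × Circle =>
    (SharpLie.triv (h := h)).symm ((sharpProj ρ γ₀)⁻¹ * x.1, x.2)) ?_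
  exact MSmoothAt.comp (f := fun x : G × Circle => ((sharpProj ρ γ₀)⁻¹ * x.1, x.2))
    (SharpLie.mSmoothAt_triv_symm (h := h) hx)
    (((MSmoothAt.const _ _).mul (MSmoothAt.fst x)).prodMk (MSmoothAt.snd x))

theorem IsIsoSharpLie.isCentralLieExtension (hL : IsIsoSharpLie h L) :
    IsCentralLieExtension E L.Model (Γ := L.Carrier) (sharpIncl ρ) (sharpProj ρ) where
  smooth_ι := smoothMapOn_univ_iff.2 hL.mSmoothAt_sharpIncl
  smooth_π := smoothMapOn_univ_iff.2 hL.mSmoothAt_sharpProj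
  injective z w hzw := by
    have h1 : scalarUnitary H z • ψ = scalarUnitary H w • ψ :=
      congrArg (fun γ => sharpRep ρ γ • ψ) hzw
    rw [scalarUnitary_smul, scalarUnitary_smul] at h1
    exact Circle.ext (smul_left_injective ℂ hψ h1)
  exact := by
    ext γ
    constructor
    · rintro ⟨z, rfl⟩
      exact sharpProj_sharpIncl z
    · intro hγ
      obtain ⟨z, hz⟩ := exists_eq_mul_sharpIncl (ρ := ρ) (γ := 1) (γ' := γ)
        ((map_one _).trans (MonoidHom.mem_ker.1 hγ).symm)
      exact ⟨z, (hz.trans (one_mul _)).symm⟩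
  surjective := sharpProj_surjective
  central := sharpIncl_central
  smooth_action := smoothMapOn_univ_iff.2 fun p =>
    (MSmoothAt.fst p).mul ((hL.mSmoothAt_sharpIncl p.2).comp (MSmoothAt.snd p))
  locally_trivial g₀ := by
    have := isTopologicalGroup_of_isLocConvexLieGroup E G
    obtain ⟨γ₀, rfl⟩ := sharpProj_surjective (ρ := ρ) g₀
    set U : Set G := {g | (sharpProj ρ γ₀)⁻¹ * g ∈ nonOrthSet ρ (Projectivization.mk ℂ ψ hψ)}
      with hU
    have hUo : IsOpen U := (isOpen_nonOrthSet hψ h).preimage (continuous_const_mul _)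
    have hπ : Continuous fun γ : L.Carrier => sharpProj ρ γ :=
      continuous_iff_continuousAt.2 fun γ => (hL.mSmoothAt_sharpProj γ).1
    have hVo : IsOpen ((fun γ : L.Carrier => sharpProj ρ γ) ⁻¹' U) := hUo.preimage hπ
    have hmem : ∀ γ : GSharp ρ, sharpProj ρ γ ∈ U →
        toSharpLie h (γ₀⁻¹ * γ) ∈ (SharpLie.triv (h := h)).source := by
      intro γ hγ
      change sharpProj ρ (γ₀⁻¹ * γ) ∈ nonOrthSet ρ (Projectivization.mk ℂ ψ hψ)
      rwa [map_mul, map_inv]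
    refine ⟨U, hUo, by simpa [hU] using one_mem_nonOrthSet hψ,
      fun x => L.toCarrier (localTriv hψ γ₀ x), ⟨?_, ?_, ?_⟩, fun g _ z => ⟨?_, fun w => ?_⟩⟩
    · exact (smoothMapOn_iff (hUo.prod isOpen_univ)).2 fun x hx => hL.mSmoothAt_localTriv γ₀ hx.1
    · intro x hx
      have := sharpProj_localTriv (hψ := hψ) γ₀ x
      exact (congrArg (· ∈ U) this).mpr hx.1
    · refine ⟨fun γ => localTrivInv ψ γ₀ γ, (smoothMapOn_iff hVo).2 fun γ hγ => ?_,
        fun γ hγ => ⟨hγ, mem_univ _⟩, fun x hx => localTrivInv_localTriv γ₀ hx.1,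
        fun γ hγ => localTriv_localTrivInv (hmem γ hγ)⟩
      refine (hL.mSmoothAt_sharpProj γ).prodMk ((MSmoothAt.snd (E := E) (M := G) _).comp
        (f := fun γ : L.Carrier => SharpLie.triv (h := h) (toSharpLie h γ₀⁻¹ * toSharpLie h γ)) ?_)
      exact (SharpLie.mSmoothAt_triv (h := h) (hmem γ hγ)).comp
        (f := fun γ : L.Carrier => toSharpLie h γ₀⁻¹ * toSharpLie h γ)
        ((SharpLie.mSmoothAt_mul_left (h := h) _ _).comp (hL.1 γ))
    · exact sharpProj_localTriv γ₀ (g, z)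
    · change localTriv hψ γ₀ (g, z * w) = localTriv hψ γ₀ (g, z) * sharpIncl ρ w
      rw [localTriv, sharpTriv_mul, ← mul_assoc]
      rfl

/-- Smooth vectors have smooth rays. -/
theorem IsIsoSharpLie.isSmoothRay (hL : IsIsoSharpLie h L) {φ : H} (hφ : φ ≠ 0)
    (hv : IsSmoothVector ρ L φ) : IsSmoothRay ρ E (Projectivization.mk ℂ φ hφ) := by
  refine smoothToProj_iff.2 fun g₀ => ?_
  obtain ⟨γ₀, rfl⟩ := sharpProj_surjective (ρ := ρ) g₀
  -- A section of G^♯ → G, smooth at the projection of γ₀; the orbit of [φ] is the projectivized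
  -- orbit of φ along it.
  have h1 : MSmoothAt E L.Model (fun g => L.toCarrier (localTriv hψ γ₀ (g, 1)))
      (sharpProj ρ γ₀) := by
    refine (hL.mSmoothAt_localTriv γ₀ ?_).comp ((MSmoothAt.id _).prodMk (MSmoothAt.const 1 _))
    simpa using one_mem_nonOrthSet hψ
  have h2 := (smoothMapOn_univ_iff.1 hv _).comp h1
  have h3 := h2.projMk (fun g => unitary_smul_ne_zero _ hφ)
  convert h3 using 2 with g
  have := rho_smul_mk (localTriv hψ γ₀ (g, 1)) hφ
  rwa [sharpProj_localTriv] at this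

/-! ### Existence -/

variable [ConnectedSpace G]

variable (h) in
/-- The Lie group structure on `G^♯` obtained from a smooth ray. -/
def sharpLieStructure : LieGroupStructure.{u} (GSharp ρ) where
  Model := E × CircleModel
  top := inferInstanceAs (TopologicalSpace (SharpLie h))
  charts := inferInstanceAs (ChartedSpace (E × CircleModel) (SharpLie h))
  isLieGroup := inferInstanceAs (IsLocConvexLieGroup (E × CircleModel) (SharpLie h))

theorem isAdapted_sharpLieStructure : IsAdapted ρ E ψ hψ (sharpLieStructure h) := by
  have h1 : IsDiffeoOn (E × CircleModel) (E × CircleModel) (SharpLie.triv (h := h)).symm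
      (nonOrthSet ρ (Projectivization.mk ℂ ψ hψ) ×ˢ univ) (SharpLie.triv (h := h)).source :=
    ⟨(smoothMapOn_iff ((isOpen_nonOrthSet hψ h).prod isOpen_univ)).2 fun x hx =>
        SharpLie.mSmoothAt_triv_symm hx.1,
      fun x hx => SharpLie.triv.map_target hx, SharpLie.triv,
      (smoothMapOn_iff SharpLie.triv.open_source).2 fun γ hγ => SharpLie.mSmoothAt_triv hγ,
      fun γ hγ => SharpLie.triv.map_source hγ,
      fun x hx => SharpLie.triv.right_inv hx, fun γ hγ => SharpLie.triv.left_inv hγ⟩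
  exact ⟨_, (SharpLie.triv (h := h)).open_source, h1⟩

/-! ### The topology -/

/-- The continuous analogue of `mSmoothAt_rep_smul_of_ray`: at 1 use the coefficient ⟨γ⁻¹ψ, φ⟩, then
translate. -/
theorem SharpLie.continuous_rep_smul_of_ray {φ : H} (hφ : φ ≠ 0)
    (hray : Continuous fun g : G => ρ g • Projectivization.mk ℂ φ hφ) (hin : inner ℂ ψ φ ≠ 0) :
    Continuous fun γ : SharpLie h => rep γ • φ := by
  have := isTopologicalGroup_of_isLocConvexLieGroup (E × CircleModel) (SharpLie h)
  have hone : ContinuousAt (fun γ : SharpLie h => rep γ • φ) 1 := by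
    refine continuousAt_of_ray (φ := ψ) (fun γ => unitary_smul_ne_zero _ hφ) ?_ ?_ ?_
    · rwa [map_one, one_smul]
    · refine (hray.comp continuous_proj).continuousAt.congr (Eventually.of_forall fun γ => ?_)
      exact rho_smul_mk (ρ := ρ) γ hφ
    · have h1 : Continuous fun γ : SharpLie h => inner ℂ (rep γ⁻¹ • ψ) φ :=
        (continuous_rep_smul.comp continuous_inv).inner continuous_const
      refine h1.continuousAt.congr (Eventually.of_forall fun γ => ?_)
      change inner ℂ (rep γ⁻¹ • ψ) φ = inner ℂ ψ (rep γ • φ)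
      rw [map_inv, unitary_inner_smul_right]
  refine continuous_iff_continuousAt.2 fun γ₀ => ?_
  have h1 : ContinuousAt (fun γ : SharpLie h => γ₀⁻¹ * γ) γ₀ :=
    (continuous_const_mul _).continuousAt
  have h2 : ContinuousAt (fun γ : SharpLie h => rep γ • φ) (γ₀⁻¹ * γ₀) := by
    rwa [inv_mul_cancel]
  have h3 := (rep γ₀ : H →L[ℂ] H).continuous.continuousAt.comp (h2.comp h1)
  refine h3.congr (Eventually.of_forall fun γ => ?_)
  change rep γ₀ • rep (γ₀⁻¹ * γ) • φ = rep γ • φ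
  rw [← mul_smul, ← map_mul, mul_inv_cancel_left]

/-- Vectors of O off the hyperplane ψ^⊥ project to an open set of rays, which meets the dense set of
continuous ones. -/
theorem exists_continuous_ray_mem (hψ : ψ ≠ 0) (hρ : IsContinuousProjRep ρ) {O : Set H}
    (hO : IsOpen O) {v : H} (hv : v ∈ O) : ∃ φ ∈ O, inner ℂ ψ φ ≠ 0 ∧ ∃ hφ : φ ≠ 0,
      Continuous fun g : G => ρ g • Projectivization.mk ℂ φ hφ := by
  have hne : ∃ u ∈ O, inner ℂ ψ u ≠ 0 := by
    by_cases h0 : inner ℂ ψ v = 0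
    -- If v lies in the hyperplane, v + t ψ leaves it while staying in O for small t ≠ 0.
    · have h1 := (((tendsto_add_smul v ψ).eventually (hO.mem_nhds hv)).filter_mono
        (nhdsWithin_le_nhds (s := {0}ᶜ))).and self_mem_nhdsWithin
      obtain ⟨t, ht, ht0⟩ := h1.exists
      refine ⟨_, ht, ?_⟩
      rw [inner_add_right, h0, zero_add, ← Complex.coe_smul, inner_smul_right]
      exact mul_ne_zero (by exact_mod_cast ht0) (inner_self_ne_zero.2 hψ)
    · exact ⟨v, hv, h0⟩
  obtain ⟨u, huO, hu⟩ := hne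
  have hu0 : u ≠ 0 := by
    rintro rfl
    simp at hu
  have hW : IsOpen {x : {x : H // x ≠ 0} | x.1 ∈ O ∧ inner ℂ ψ x.1 ≠ 0} :=
    (hO.preimage continuous_subtype_val).inter (isOpen_ne_fun (by fun_prop) continuous_const)
  obtain ⟨_, ⟨x, hx, rfl⟩, hp⟩ := hρ.inter_open_nonempty _ (isOpenMap_projMk _ hW)
    ⟨_, ⟨u, hu0⟩, ⟨huO, hu⟩, rfl⟩
  exact ⟨x.1, hx.1, hx.2, x.2, hp⟩

/-- Unitaries are isometries, so approximating v by vectors with continuous orbits approximates its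
orbit map uniformly in γ. -/
theorem SharpLie.continuous_rep_smul_of_dense (hρ : IsContinuousProjRep ρ) (v : H) :
    Continuous fun γ : SharpLie h => rep γ • v := by
  refine continuous_iff_continuousAt.2 fun γ₀ => Metric.tendsto_nhds.2 fun ε hε => ?_
  obtain ⟨φ, hφv, hin, hφ, hray⟩ := exists_continuous_ray_mem hψ hρ Metric.isOpen_ball
    (Metric.mem_ball_self (x := v) (by positivity : 0 < ε / 3))
  have hdist : ∀ γ : SharpLie h, dist (rep γ • φ) (rep γ • v) < ε / 3 := by
    intro γ
    rw [dist_eq_norm, ← smul_sub, unitary_norm_smul, ← dist_eq_norm]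
    exact hφv
  filter_upwards [Metric.tendsto_nhds.1 ((continuous_rep_smul_of_ray hφ hray hin).tendsto γ₀)
    (ε / 3) (by positivity)] with γ hγ
  have h1 := dist_triangle4 (rep γ • v) (rep γ • φ) (rep γ₀ • φ) (rep γ₀ • v)
  have h2 := hdist γ
  rw [dist_comm] at h2
  linarith [hdist γ₀]

/-- The model topology is induced by the projection and the single orbit of ψ, so it is coarser than
the strong one; equality amounts to continuity of all orbit maps. -/
theorem IsIsoSharpLie.top_eq (hL : IsIsoSharpLie h L) (hρ : IsContinuousProjRep ρ) :
    L.top = strongTopology ρ := by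
  let t : TopologicalSpace (GSharp ρ) := inferInstanceAs (TopologicalSpace (SharpLie h))
  have h1 : L.top ≤ t := by
    have : Continuous fun γ : L.Carrier => toSharpLie h γ :=
      continuous_iff_continuousAt.2 fun γ => (hL.1 γ).1
    exact fun O hO => this.isOpen_preimage O hO
  have h2 : t ≤ L.top := by
    have : Continuous fun γ : SharpLie h => L.toCarrier γ :=
      continuous_iff_continuousAt.2 fun γ => (hL.2 γ).1
    exact fun O hO => this.isOpen_preimage O hO
  have h3 : t ≤ strongTopology ρ := continuous_iff_le_induced.1
    (SharpLie.continuous_proj.prodMk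
      (continuous_pi fun v => SharpLie.continuous_rep_smul_of_dense (h := h) hρ v))
  have h4 : strongTopology ρ ≤ t := by
    have h5 : Continuous fun p : G × (H → H) => (p.1, p.2 ψ) := by fun_prop
    exact (induced_mono h5.le_induced).trans_eq induced_compose
  exact (le_antisymm h1 h2).trans (le_antisymm h3 h4)

end Adapted
end

theorem theorem4p4
    {E : Type u} [AddCommGroup E] [Module ℝ E] [TopologicalSpace E] [IsTopologicalAddGroup E]
    [ContinuousSMul ℝ E] [LocallyConvexSpace ℝ E] [T2Space E]
    {G : Type v} [Group G] [TopologicalSpace G] [ChartedSpace E G] [IsLocConvexLieGroup E G]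
    [ConnectedSpace G]
    {H : Type w} [NormedAddCommGroup H] [InnerProductSpace ℂ H] [CompleteSpace H]
    (ρ : G →* ProjUnitaryGp H) (ψ : H) (hψ : ψ ≠ 0)
    (hsmooth : IsSmoothRay ρ E (Projectivization.mk ℂ ψ hψ)) :
    -- the neighbourhood `U_ψ` and the lift `ρ_ψ`
    (IsOpen (nonOrthSet ρ (Projectivization.mk ℂ ψ hψ)) ∧
      1 ∈ nonOrthSet ρ (Projectivization.mk ℂ ψ hψ) ∧
      (∀ g ∈ nonOrthSet ρ (Projectivization.mk ℂ ψ hψ),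
        g⁻¹ ∈ nonOrthSet ρ (Projectivization.mk ℂ ψ hψ)) ∧
      (∀ g ∈ nonOrthSet ρ (Projectivization.mk ℂ ψ hψ),
        IsNormalizedLift ρ ψ g (normalizedLift ρ ψ hψ g) ∧
        (∀ U : UnitaryGp H, IsNormalizedLift ρ ψ g U → U = normalizedLift ρ ψ hψ g) ∧
        normalizedLift ρ ψ hψ g⁻¹ = (normalizedLift ρ ψ hψ g)⁻¹) ∧
      SmoothMapOn E H (fun g : G => normalizedLift ρ ψ hψ g • ψ)
        (nonOrthSet ρ (Projectivization.mk ℂ ψ hψ))) ∧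
    -- existence of the Lie group structure; equivariance of `τ_ψ`
    (∃ L : LieGroupStructure.{u} (GSharp ρ), IsAdapted ρ E ψ hψ L) ∧
    (∀ (g : G) (z w : Circle),
      sharpTriv ρ ψ hψ (g, z * w) = sharpTriv ρ ψ hψ (g, z) * sharpIncl ρ w) ∧
    -- properties of the Lie group structure obtained from `[ψ]`
    (∀ L : LieGroupStructure.{u} (GSharp ρ), IsAdapted ρ E ψ hψ L →
      -- it is unique
      (∀ L' : LieGroupStructure.{u} (GSharp ρ), IsAdapted ρ E ψ hψ L' → L.Coincide L') ∧
      -- it is a central Lie group extension and a principal bundle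
      IsCentralLieExtension E L.Model (Γ := L.Carrier) (sharpIncl ρ) (sharpProj ρ) ∧
      -- if `ρ` is continuous, its topology is that of the topological group `G^♯`
      (IsContinuousProjRep ρ → L.top = strongTopology ρ) ∧
      -- `ψ` is a smooth vector
      IsSmoothVector ρ L ψ ∧
      -- smooth rays that are not orthogonal to `[ψ]`
      (∀ (φ : H) (hφ : φ ≠ 0), inner ℂ ψ φ ≠ 0 →
        IsSmoothRay ρ E (Projectivization.mk ℂ φ hφ) →
        IsSmoothVector ρ L φ ∧
        ∀ L' : LieGroupStructure.{u} (GSharp ρ), IsAdapted ρ E φ hφ L' → L.Coincide L') ∧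
      -- the case of a smooth projective representation
      (Dense {p : ℙ ℂ H | IsSmoothRay ρ E p} →
        (∀ (φ : H) (hφ : φ ≠ 0), IsSmoothRay ρ E (Projectivization.mk ℂ φ hφ) →
          ∀ L' : LieGroupStructure.{u} (GSharp ρ), IsAdapted ρ E φ hφ L' → L.Coincide L') ∧
        ∀ (φ : H) (hφ : φ ≠ 0),
          IsSmoothVector ρ L φ ↔ IsSmoothRay ρ E (Projectivization.mk ℂ φ hφ))) := by
  refine ⟨⟨isOpen_nonOrthSet hψ hsmooth, one_mem_nonOrthSet hψ,
    fun g hg => inv_mem_nonOrthSet hψ hg, fun g hg => ⟨isNormalizedLift_normalizedLift hψ hg,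
      fun U hU => normalizedLift_unique hψ hU, normalizedLift_inv hψ hg⟩,
    (smoothMapOn_iff (isOpen_nonOrthSet hψ hsmooth)).2 fun g hg =>
      mSmoothAt_normalizedLift hψ hsmooth hg⟩,
    ⟨sharpLieStructure hsmooth, isAdapted_sharpLieStructure⟩, sharpTriv_mul hψ, fun L hL => ?_⟩
  -- Properties of an arbitrary adapted structure are transported from the explicit model.
  have hiso : IsIsoSharpLie hsmooth L := hL.isIsoSharpLie
  refine ⟨fun L' hL' => hiso.coincide hL'.isIsoSharpLie, hiso.isCentralLieExtension, hiso.top_eq,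
    hiso.isSmoothVector, fun φ hφ hin hray => ?_, fun hd => ⟨fun φ hφ hray L' hL' => ?_,
      fun φ hφ => ⟨hiso.isSmoothRay hφ, fun hray => (hiso.of_dense hd hray).isSmoothVector⟩⟩⟩
  · have hiso' := hiso.of_inner_ne_zero hray hin
    exact ⟨hiso'.isSmoothVector, fun L' hL' => hiso'.coincide hL'.isIsoSharpLie⟩
  · exact (hiso.of_dense hd hray).coincide hL'.isIsoSharpLie
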